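/- **Theorem.** *Definitions.* Let $G$ be an infinite, locally finite, connected graph with vertex set $V$, root $o\in V$, graph distance $\operatorname{dist}$ and balls $B_R(v)=\{w\in V:\operatorname{dist}(v,w)\le R\}$. For $\lambda,p\in(0,1]$, *Bernoulli–Voronoi percolation* $\omega_p^{(\lambda)}$ on $G$ is the following random subset of $V$. Let every vertex be a point independently with probability $\lambda$, and give the points i.i.d. labels, uniform on $[0,1]$. Assign every vertex to the nearest point, ties being resolved in favour of the smaller label; the set of vertices assigned to a point is its *cell*. Colour each cell black independently with probability $p$, and let $\omega_p^{(\lambda)}$ be the union of the black cells. Write $\mathbb P_p^{(\lambda)}$ for its law. A *cluster* is a connected component of the subgraph induced by $\omega_p^{(\lambda)}$, and $u\leftrightarrow v$ is the event that $u$ and $v$ lie in the same cluster. Let $A(\lambda,p,R,v)$ be the event that $\omega_p^{(\lambda)}$ intersects $B_R(v)$ and that $\omega_p^{(\lambda)}\cap B_{3R}(v)$ is contained in a single cluster of $\omega_p^{(\lambda)}$. Bernoulli–Voronoi percolation on $G$ has *local uniqueness at low intensities* if for every $p_0\in(0,1]$ and every $\varepsilon>0$ there exist $R>0$ and $\lambda_0\in(0,1)$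 such that $$\inf_{0<\lambda\le\lambda_0}\mathbb P\big(A(\lambda,p_0,R,o)\big)>1-\varepsilon .$$ *Statement.* Let $X$ and $Y$ be Cayley graphs of infinite finitely generated groups with respect to finite generating sets. Suppose that $X$ is non-amenable, i.e. $\inf_K |\partial_E K|/|K|>0$, where $K$ runs over the non-empty finite sets of vertices of $X$ and $\partial_E K$ is the set of edges between $K$ and its complement. Let $G=X\times Y$ be the direct product: $(x,y)$ and $(x',y')$ are adjacent if $x=x'$ and $y\sim y'$, or $y=y'$ and $x\sim x'$. Suppose that Bernoulli–Voronoi percolation on $G$, rooted at the pair of identity elements, has local uniqueness at low intensities. Then for every $p_0\in(0,1]$ there exists $\lambda_0>0$ such that $$\inf_{u,v\in V(X\times Y)}\mathbb P_{p_0}^{(\lambda)}(u\leftrightarrow v)>0\qquad\text{for all }\lambda\in(0,1]\text{ with }\lambda<\lambda_0 .$$ -/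

import Mathlib

open MeasureTheory Set

open scoped unitInterval

noncomputable section

namespace BernoulliVoronoi

/-! ### Graph notions -/

section Graph

variable {V : Type*}

/-- The ball of radius `R` around `v` in the graph distance. -/
def ball (G : SimpleGraph V) (v : V) (R : ℝ) : Set V :=
  {w | (G.dist v w : ℝ) ≤ R}

/-- `u ↔ v` in the site configuration `ω`: there is a path between `u` and `v` in the subgraph of
`G` induced by `ω` (in particular both endpoints belong to `ω`). -/
def ConnectedIn (G : SimpleGraph V) (ω : Set V) (u v : V) : Prop :=
  ∃ w : G.Walk u v, ∀ x ∈ w.support, x ∈ ω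

/-- The `ω`-cluster of `u`: the connected component of `u` in the subgraph induced by `ω`
(empty if `u ∉ ω`). -/
def cluster (G : SimpleGraph V) (ω : Set V) (u : V) : Set V :=
  {w | ConnectedIn G ω u w}

/-- The edge boundary of `K`: all edges with one endpoint in `K` and the other outside `K`. -/
def edgeBoundary (G : SimpleGraph V) (K : Set V) : Set (Sym2 V) :=
  {e ∈ G.edgeSet | ∃ u ∈ K, ∃ v ∉ K, e = s(u, v)}

/-- The edge-isoperimetric constant of a locally finite graph: the infimum of `|∂_E K| / |K|` over
all non-empty finite vertex sets `K`. -/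
def edgeIsoperimetricConstant (G : SimpleGraph V) : ℝ :=
  ⨅ K : {K : Finset V // K.Nonempty}, ((edgeBoundary G K.1).ncard : ℝ) / (K.1.card : ℝ)

/-- A locally finite graph is non-amenable if its edge-isoperimetric constant is positive. -/
def IsNonamenable (G : SimpleGraph V) : Prop :=
  0 < edgeIsoperimetricConstant G

end Graph

/-! ### The percolation model -/

section Model

variable {V : Type*}

/-- The randomness: every vertex `v` carries three uniform variables in `[0, 1]`, namely
* `(x v).1`, which decides whether `v` is a point of the Bernoulli process,
* `(x v).2.1`, the label used to break ties, and
* `(x v).2.2`, which decides whether the cell of `v` is black, if `v` is a point. -/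
abbrev Randomness (V : Type*) : Type _ := V → I × I × I

/-- All variables of all vertices are independent and uniform in `[0, 1]`. -/
def law (V : Type*) : Measure (Randomness V) :=
  Measure.infinitePi fun _ : V => (volume : Measure (I × I × I))

/-- The `lam`-Bernoulli point process: every vertex is a point independently with probability
`lam`. -/
def points (lam : ℝ) (x : Randomness V) : Set V :=
  {v | ((x v).1 : ℝ) ≤ lam}

/-- The tie-breaking label of a vertex. -/
def label (x : Randomness V) (v : V) : I := (x v).2.1

/-- The Voronoi cell of the point `c`: all vertices closer to `c` than to any other point, where
ties are decided in favour of the smaller label. (Labels are almost surely distinct.) -/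
def cell (G : SimpleGraph V) (lam : ℝ) (x : Randomness V) (c : V) : Set V :=
  {v | ∀ c' ∈ points lam x, c' ≠ c →
    G.dist v c < G.dist v c' ∨ (G.dist v c = G.dist v c' ∧ label x c < label x c')}

/-- The points whose cells are black: every point independently with probability `p`. -/
def blackPoints (lam p : ℝ) (x : Randomness V) : Set V :=
  {c ∈ points lam x | ((x c).2.2 : ℝ) ≤ p}

/-- Bernoulli--Voronoi percolation with intensity `lam` and survival probability `p`: the union of
all black cells. -/
def percolation (G : SimpleGraph V) (lam p : ℝ) (x : Randomness V) : Set V :=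
  ⋃ c ∈ blackPoints lam p x, cell G lam x c

/-- The probability that the configuration of Bernoulli--Voronoi percolation with intensity `lam`
and survival probability `p` has the property `E`. -/
def prob (G : SimpleGraph V) (lam p : ℝ) (E : Set V → Prop) : ℝ :=
  (law V).real {x | E (percolation G lam p x)}

/-- The good configurations for local uniqueness: `ω` intersects the ball of radius `R` around `v`,
and its part in the ball of radius `3R` is contained in a single cluster. -/
def IsGood (G : SimpleGraph V) (R : ℝ) (v : V) (ω : Set V) : Prop :=
  (ω ∩ ball G v R).Nonempty ∧ ∃ u ∈ ω, ω ∩ ball G v (3 * R) ⊆ cluster G ω u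

/-- Local uniqueness at low intensities, for a graph with root `o`. -/
def LocalUniquenessAtLowIntensities (G : SimpleGraph V) (o : V) : Prop :=
  ∀ p₀ : ℝ, 0 < p₀ → p₀ ≤ 1 → ∀ ε : ℝ, 0 < ε →
    ∃ R : ℝ, 0 < R ∧ ∃ lam₀ : ℝ, 0 < lam₀ ∧ lam₀ < 1 ∧
      1 - ε < ⨅ lam : Ioc (0 : ℝ) lam₀, prob G lam p₀ (IsGood G R o)

/-- The infimum of the two-point function over all pairs of vertices. -/
def infTwoPoint (G : SimpleGraph V) (lam p : ℝ) : ℝ :=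
  ⨅ uv : V × V, prob G lam p fun ω => ConnectedIn G ω uv.1 uv.2

end Model

end BernoulliVoronoi

end

/-! Call two vertices `Linked` at scale `R` if both are good and the configurations in their
`R`-balls meet a common cluster. A good vertex sees only one cluster nearby, so linking is
transitive; if each vertex is good with probability at least `1 - ε`, then equal or adjacent
vertices are linked with probability at least `1 - 2 * ε`. Inserting black points in both `R`-balls
turns linking into connection at a cost independent of the two vertices
(`pow_mul_prob_linked_le_prob_connectedIn`). It therefore suffices to link any two vertices with
probability at least `1 / 2`.

Local information is propagated by a dichotomy. A left shift by a generator `s` of `Γ` moves `(1,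
1)` and `(1, b)` to `(s, 1)` and `(s, b)`, each equal or adjacent to the original. So the event that
`(1, 1)` and `(1, b)` are linked is almost invariant, uniformly in `b`, and a spectral gap forces
its probability to be near 0 or 1 (`exists_law_real_mul_le_of_isNonamenable`). Changing `b` by one
generator changes this probability only slightly, so it stays near 1 for every `b`. Consequently,
shifts by arbitrary elements of `Δ` hardly change the event that `(1, 1)` and `(a, 1)` are linked.
Mixing of the infinite group `Δ` gives the same dichotomy (`law_real_mul_le_of_infinite`), and
walking along `a` finishes the argument.

For the spectral gap, Cheeger's inequality gives exponential decay of the coefficients of powers of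
the lazy walk. Self-adjointness makes `‖W ^ n f‖` log-convex in `n`, so vectors with finitely many
nonzero matrix coefficients are contracted at the same rate. Centered cylinder events are such
vectors, and the resulting Poincaré inequality passes to limits. Its constant depends only on the
group and generators, so `ε` can be fixed before `R` and the intensity. -/

open scoped RealInnerProductSpace ENNReal

noncomputable section

namespace BernoulliVoronoi

/-! ### Isoperimetry and Cheeger's inequality on Cayley graphs -/

section Isoperimetry

variable {Γ : Type*} [Group Γ]

theorem le_ncard_edgeBoundary {V : Type*} (G : SimpleGraph V) (K : Finset V) (hK : K.Nonempty) :
    edgeIsoperimetricConstant G * K.card ≤ (edgeBoundary G (K : Set V)).ncard := by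
  have h : edgeIsoperimetricConstant G ≤ ((edgeBoundary G (K : Set V)).ncard : ℝ) / K.card :=
    ciInf_le (f := fun K : {K : Finset V // K.Nonempty} =>
      ((edgeBoundary G (K.1 : Set V)).ncard : ℝ) / (K.1.card : ℝ))
      ⟨0, by rintro _ ⟨K, rfl⟩; positivity⟩ ⟨K, hK⟩
  have : (0 : ℝ) < K.card := by exact_mod_cast hK.card_pos
  rwa [le_div_iff₀ this] at h

theorem nonempty_of_isNonamenable_mulCayley {S : Finset Γ}
    (hX : IsNonamenable (SimpleGraph.mulCayley (S : Set Γ))) : S.Nonempty := by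
  by_contra h
  rw [Finset.not_nonempty_iff_eq_empty] at h
  subst h
  have h1 := le_ncard_edgeBoundary (SimpleGraph.mulCayley ((∅ : Finset Γ) : Set Γ)) {1} (by simp)
  have h2 : edgeBoundary (SimpleGraph.mulCayley ((∅ : Finset Γ) : Set Γ))
      (({1} : Finset Γ) : Set Γ) = ∅ := by
    ext e; simp [edgeBoundary]
  rw [h2] at h1
  simp only [Finset.card_singleton, Nat.cast_one, mul_one, Set.ncard_empty, Nat.cast_zero] at h1
  exact absurd hX (not_lt.mpr h1)

open Classical in
/-- The edge boundary of `K` in a Cayley graph is counted by its directed edges. -/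
theorem ncard_edgeBoundary_mulCayley_le (S U K : Finset Γ) (hU : K ⊆ U)
    (hUS : ∀ s ∈ S, ∀ x, x * s ∈ K → x ∈ U) :
    ((edgeBoundary (SimpleGraph.mulCayley (S : Set Γ)) (K : Set Γ)).ncard : ℝ) ≤
      ∑ s ∈ S, ∑ x ∈ U, |(if x * s ∈ K then (1 : ℝ) else 0) - if x ∈ K then 1 else 0| := by
  set P : Finset (Γ × Γ) := (S ×ˢ U).filter fun q => ¬ (q.2 * q.1 ∈ K ↔ q.2 ∈ K) with hP
  -- An edge between `x` and `x * s` may leave `K` in either direction; when `x` is the outer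
  -- endpoint, `hUS` is what places it in `U`.
  have h1 : edgeBoundary (SimpleGraph.mulCayley (S : Set Γ)) (K : Set Γ) ⊆
      (P.image fun q => s(q.2, q.2 * q.1) : Finset (Sym2 Γ)) := by
    rintro e ⟨he, u, hu, v, hv, rfl⟩
    rw [SimpleGraph.mem_edgeSet, SimpleGraph.mulCayley_adj'] at he
    obtain ⟨-, s, hs, h | h⟩ := he
    · subst h
      simp only [Finset.coe_image, Set.mem_image]
      refine ⟨(s, u), ?_, rfl⟩
      simp only [hP, Finset.coe_filter, Finset.mem_product, Set.mem_ofPred_eq]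
      exact ⟨⟨hs, hU hu⟩, fun h => hv (h.2 hu)⟩
    · subst h
      simp only [Finset.coe_image, Set.mem_image]
      refine ⟨(s, v), ?_, Sym2.eq_swap⟩
      simp only [hP, Finset.coe_filter, Finset.mem_product, Set.mem_ofPred_eq]
      exact ⟨⟨hs, hUS s hs v hu⟩, fun h => hv (h.1 hu)⟩
  have h2 : (edgeBoundary (SimpleGraph.mulCayley (S : Set Γ)) (K : Set Γ)).ncard ≤ P.card := by
    refine (Set.ncard_le_ncard h1 (Finset.finite_toSet _)).trans ?_
    rw [Set.ncard_coe_finset]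
    exact Finset.card_image_le
  have h3 : (P.card : ℝ) =
      ∑ s ∈ S, ∑ x ∈ U, |(if x * s ∈ K then (1 : ℝ) else 0) - if x ∈ K then 1 else 0| := by
    rw [← Finset.sum_product', hP, Finset.card_filter]
    push_cast
    refine Finset.sum_congr rfl fun q _ => ?_
    by_cases ha : q.2 * q.1 ∈ K <;> by_cases hb : q.2 ∈ K <;> simp [ha, hb]
  rw [← h3]
  exact_mod_cast h2

/-- The discrete co-area inequality on a Cayley graph. -/
theorem edgeIsoperimetricConstant_mul_sum_le (S U : Finset Γ) (g : Γ → ℝ) (hg : ∀ x, 0 ≤ g x)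
    (hU : ∀ x, g x ≠ 0 → x ∈ U) (hUS : ∀ s ∈ S, ∀ x, g (x * s) ≠ 0 → x ∈ U) :
    edgeIsoperimetricConstant (SimpleGraph.mulCayley (S : Set Γ)) * ∑ x ∈ U, g x ≤
      ∑ s ∈ S, ∑ x ∈ U, |g (x * s) - g x| := by
  classical
  induction hn : (U.filter fun x => g x ≠ 0).card using Nat.strong_induction_on generalizing g with
  | _ n ih =>
  set K := U.filter fun x => g x ≠ 0 with hK
  have memK : ∀ x, x ∈ K ↔ g x ≠ 0 := fun x => by
    rw [hK, Finset.mem_filter]; exact ⟨fun h => h.2, fun h => ⟨hU x h, h⟩⟩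
  rcases K.eq_empty_or_nonempty with h0 | h0
  · have hz : ∀ x, g x = 0 := fun x => by
      by_contra h; have := (memK x).2 h; rw [h0] at this; simp at this
    simp [hz]
  -- Peel off the bottom layer: subtracting the smallest positive value `t` on the support leaves a
  -- nonnegative function with smaller support.
  obtain ⟨a, haK, ha⟩ := K.exists_min_image g h0
  set t := g a with ht
  have htpos : 0 < t := lt_of_le_of_ne (hg a) ((memK a).1 haK).symm
  set i : Γ → ℝ := fun x => if x ∈ K then 1 else 0 with hi
  set g' : Γ → ℝ := fun x => g x - t * i x with hg'
  have g'0 : ∀ x, x ∉ K → g x = 0 := fun x hx => by by_contra h; exact hx ((memK x).2 h)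
  have hg'nn : ∀ x, 0 ≤ g' x := fun x => by
    by_cases hx : x ∈ K
    · simp only [hg', hi, hx, if_true]; linarith [ha x hx]
    · simp [hg', hi, hx, g'0 x hx]
  have hg'ne : ∀ x, g' x ≠ 0 → g x ≠ 0 := fun x hx h => by
    have : x ∉ K := fun h' => (memK x).1 h' h
    exact hx (by simp [hg', hi, this, h])
  have hcard : (U.filter fun x => g' x ≠ 0).card < n := by
    rw [← hn]
    refine Finset.card_lt_card (Finset.ssubset_iff_subset_ne.2 ⟨fun x hx => ?_, fun h => ?_⟩)
    · rw [Finset.mem_filter] at hx; exact (memK x).2 (hg'ne x hx.2)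
    · have := haK; rw [← h, Finset.mem_filter] at this
      exact this.2 (by simp [hg', hi, haK, ht])
  have h1 := ih _ hcard g' hg'nn (fun x hx => hU x (hg'ne x hx))
    (fun s hs x hx => hUS s hs x (hg'ne _ hx)) rfl
  have h2 := (le_ncard_edgeBoundary (SimpleGraph.mulCayley (S : Set Γ)) K h0).trans
    (ncard_edgeBoundary_mulCayley_le S U K (Finset.filter_subset _ _)
      fun s hs x hx => hUS s hs x ((memK _).1 hx))
  have h3 : ∑ x ∈ U, g x = ∑ x ∈ U, g' x + t * K.card := by
    have : (K.card : ℝ) = ∑ x ∈ U, i x := by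
      rw [hi, Finset.sum_ite_mem, Finset.inter_eq_right.2 (Finset.filter_subset _ _),
        Finset.sum_const, nsmul_eq_mul, mul_one]
    rw [this, Finset.mul_sum, ← Finset.sum_add_distrib]
    exact Finset.sum_congr rfl fun x _ => by simp [hg']
  -- No cancellation occurs: across the boundary of `K` both layers change in the same direction,
  -- since `g'` is nonnegative and vanishes off `K`.
  have h4 : ∀ x y, |g y - g x| = |g' y - g' x| + t * |i y - i x| := fun x y => by
    by_cases hx : x ∈ K <;> by_cases hy : y ∈ K
    · simp [hg', hi, hx, hy]
    · have e1 := hg'nn x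
      simp only [hg', hi, hx, hy, g'0 y hy, if_true, if_false] at e1 ⊢
      rw [abs_of_nonpos (by linarith), abs_of_nonpos (by linarith)]; norm_num
    · have e1 := hg'nn y
      simp only [hg', hi, hx, hy, g'0 x hx, if_true, if_false] at e1 ⊢
      rw [abs_of_nonneg (by linarith), abs_of_nonneg (by linarith)]; norm_num
    · simp [hg', hi, hx, hy, g'0]
  calc _ = edgeIsoperimetricConstant (SimpleGraph.mulCayley (S : Set Γ)) * ∑ x ∈ U, g' x
        + t * (edgeIsoperimetricConstant (SimpleGraph.mulCayley (S : Set Γ)) * K.card) := by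
        rw [h3]; ring
    _ ≤ ∑ s ∈ S, ∑ x ∈ U, |g' (x * s) - g' x| + t * ∑ s ∈ S, ∑ x ∈ U, |i (x * s) - i x| :=
        add_le_add h1 (mul_le_mul_of_nonneg_left h2 htpos.le)
    _ = _ := by
        rw [Finset.mul_sum, ← Finset.sum_add_distrib]
        refine Finset.sum_congr rfl fun s _ => ?_
        rw [Finset.mul_sum, ← Finset.sum_add_distrib]
        exact Finset.sum_congr rfl fun x _ => (h4 _ _).symm

/-- Cheeger's inequality on a Cayley graph. -/
theorem edgeIsoperimetricConstant_sq_mul_sum_sq_le (S U : Finset Γ) (φ : Γ → ℝ)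
    (hS : 0 < edgeIsoperimetricConstant (SimpleGraph.mulCayley (S : Set Γ))) (hSne : S.Nonempty)
    (hU : ∀ x, φ x ≠ 0 → x ∈ U) (hUS : ∀ s ∈ S, ∀ x, φ (x * s) ≠ 0 → x ∈ U) :
    edgeIsoperimetricConstant (SimpleGraph.mulCayley (S : Set Γ)) ^ 2 / (4 * S.card) *
      ∑ x ∈ U, φ x ^ 2 ≤ ∑ s ∈ S, ∑ x ∈ U, (φ (x * s) - φ x) ^ 2 := by
  classical
  set h := edgeIsoperimetricConstant (SimpleGraph.mulCayley (S : Set Γ))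
  have hd : (0 : ℝ) < S.card := by exact_mod_cast hSne.card_pos
  have h1 := edgeIsoperimetricConstant_mul_sum_le S U (fun x => φ x ^ 2) (fun x => sq_nonneg _)
    (fun x hx => hU x fun h => hx (by simp [h])) (fun s hs x hx => hUS s hs x fun h => hx (by simp [h]))
  have h2 : ∀ s ∈ S, ∑ x ∈ U, φ (x * s) ^ 2 ≤ ∑ x ∈ U, φ x ^ 2 := fun s hs => by
    have e : ∑ x ∈ U, φ (x * s) ^ 2 = ∑ y ∈ U.image (· * s), φ y ^ 2 := by
      rw [Finset.sum_image fun x _ y _ hxy => mul_right_cancel hxy]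
    have e2 : ∑ y ∈ U.image (· * s) ∩ U, φ y ^ 2 = ∑ y ∈ U.image (· * s), φ y ^ 2 := by
      refine Finset.sum_subset Finset.inter_subset_left fun x hx hx' => ?_
      by_contra hne
      exact hx' (Finset.mem_inter.2 ⟨hx, hU x fun h => hne (by simp [h])⟩)
    rw [e, ← e2]
    exact Finset.sum_le_sum_of_subset_of_nonneg Finset.inter_subset_right fun _ _ _ => sq_nonneg _
  have h3 : ∀ s ∈ S, ∑ x ∈ U, |φ (x * s) ^ 2 - φ x ^ 2| ≤
      2 * S.card / h * ∑ x ∈ U, (φ (x * s) - φ x) ^ 2 + h / (2 * S.card) * ∑ x ∈ U, φ x ^ 2 := by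
    intro s hs
    have : ∀ x ∈ U, |φ (x * s) ^ 2 - φ x ^ 2| ≤ 2 * S.card / h * (φ (x * s) - φ x) ^ 2 +
        (h / (4 * S.card) * φ (x * s) ^ 2 + h / (4 * S.card) * φ x ^ 2) := by
      intro x _
      set a := φ (x * s); set b := φ x
      -- This AM-GM weight makes the `φ ^ 2` terms, summed over `S`, equal to half the left side of
      -- the co-area inequality, so they can be absorbed.
      set η := h / (4 * (S.card : ℝ)) with hη
      have hηpos : 0 < η := by positivity
      have e : 2 * (S.card : ℝ) / h = (2 * η)⁻¹ := by rw [hη]; field_simp; norm_num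
      rw [e, show a ^ 2 - b ^ 2 = (a - b) * (a + b) by ring, abs_mul]
      have h5 : |a - b| * |a + b| ≤ (2 * η)⁻¹ * |a - b| ^ 2 + η / 2 * |a + b| ^ 2 := by
        have : (2 * η)⁻¹ * |a - b| ^ 2 + η / 2 * |a + b| ^ 2 - |a - b| * |a + b| =
          (2 * η)⁻¹ * (|a - b| - η * |a + b|) ^ 2 := by field_simp; ring
        have h6 : 0 ≤ (2 * η)⁻¹ * (|a - b| - η * |a + b|) ^ 2 := by positivity
        linarith
      rw [sq_abs, sq_abs] at h5
      nlinarith [mul_nonneg hηpos.le (sq_nonneg (a - b))]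
    refine (Finset.sum_le_sum this).trans ?_
    rw [Finset.sum_add_distrib, Finset.sum_add_distrib, ← Finset.mul_sum, ← Finset.mul_sum,
      ← Finset.mul_sum]
    have h7 := mul_le_mul_of_nonneg_left (h2 s hs) (show 0 ≤ h / (4 * S.card) by positivity)
    have h8 : h / (2 * (S.card : ℝ)) = h / (4 * S.card) + h / (4 * S.card) := by
      field_simp; norm_num
    rw [h8, add_mul]
    linarith
  have h4 := h1.trans (Finset.sum_le_sum h3)
  rw [Finset.sum_add_distrib, ← Finset.mul_sum, Finset.sum_const, nsmul_eq_mul] at h4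
  have h5 : (S.card : ℝ) * (h / (2 * S.card) * ∑ x ∈ U, φ x ^ 2) = h / 2 * ∑ x ∈ U, φ x ^ 2 := by
    field_simp
  rw [h5] at h4
  have h6 : h / 2 * ∑ x ∈ U, φ x ^ 2 ≤
      2 * S.card / h * ∑ s ∈ S, ∑ x ∈ U, (φ (x * s) - φ x) ^ 2 := by linarith
  have h7 := mul_le_mul_of_nonneg_left h6 (show 0 ≤ h / (2 * S.card) by positivity)
  have e1 : h / (2 * (S.card : ℝ)) * (h / 2 * ∑ x ∈ U, φ x ^ 2) =
    h ^ 2 / (4 * S.card) * ∑ x ∈ U, φ x ^ 2 := by field_simp; ring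
  have e2 : h / (2 * (S.card : ℝ)) *
    (2 * S.card / h * ∑ s ∈ S, ∑ x ∈ U, (φ (x * s) - φ x) ^ 2) =
    ∑ s ∈ S, ∑ x ∈ U, (φ (x * s) - φ x) ^ 2 := by field_simp
  rwa [e1, e2] at h7

end Isoperimetry

/-! ### Lazy random walks in orthogonal representations -/

section SpectralGap

variable {Γ : Type*} [Group Γ]

/-- The lazy symmetric random walk step, as an element of the group algebra. -/
def lazyStep (S : Finset Γ) : MonoidAlgebra ℝ Γ :=
  (2⁻¹ : ℝ) • 1 + (4 * (S.card : ℝ))⁻¹ •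
    ∑ s ∈ S, (MonoidAlgebra.of ℝ Γ s + MonoidAlgebra.of ℝ Γ s⁻¹)

section Representation

variable {H : Type*} [NormedAddCommGroup H] [InnerProductSpace ℝ H]
  (π : Γ →* Module.End ℝ H)

/-- The lazy random walk operator of a representation. -/
def walkOperator (S : Finset Γ) : Module.End ℝ H :=
  MonoidAlgebra.lift ℝ (Module.End ℝ H) Γ π (lazyStep S)

theorem walkOperator_apply (S : Finset Γ) (f : H) :
    walkOperator π S f =
      (2⁻¹ : ℝ) • f + (4 * (S.card : ℝ))⁻¹ • ∑ s ∈ S, (π s f + π s⁻¹ f) := by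
  simp only [walkOperator, lazyStep, map_add, map_smul, map_one, map_sum, MonoidAlgebra.lift_of,
    LinearMap.add_apply, LinearMap.smul_apply, Module.End.one_apply, LinearMap.sum_apply]

variable {π}

theorem inner_map_map_of_norm_map (hπ : ∀ γ f, ‖π γ f‖ = ‖f‖) (γ : Γ) (f g : H) :
    ⟪π γ f, π γ g⟫ = ⟪f, g⟫ := by
  have h1 := hπ γ (f + g)
  rw [real_inner_eq_norm_add_mul_self_sub_norm_mul_self_sub_norm_mul_self_div_two,
    real_inner_eq_norm_add_mul_self_sub_norm_mul_self_sub_norm_mul_self_div_two,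
    ← map_add, hπ, hπ, hπ]

theorem inner_map_left (hπ : ∀ γ f, ‖π γ f‖ = ‖f‖) (γ : Γ) (f g : H) :
    ⟪π γ f, g⟫ = ⟪f, π γ⁻¹ g⟫ := by
  rw [← inner_map_map_of_norm_map hπ γ f, ← Module.End.mul_apply, ← map_mul]
  simp

theorem inner_walkOperator_left (hπ : ∀ γ f, ‖π γ f‖ = ‖f‖) (S : Finset Γ) (f g : H) :
    ⟪walkOperator π S f, g⟫ = ⟪f, walkOperator π S g⟫ := by
  simp only [walkOperator_apply, inner_add_left, inner_add_right, inner_smul_left,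
    inner_smul_right, sum_inner, inner_sum, inner_map_left hπ, inv_inv]
  congr 2
  exact Finset.sum_congr rfl fun s _ => add_comm _ _

theorem inner_walkOperator_pow_left (hπ : ∀ γ f, ‖π γ f‖ = ‖f‖) (S : Finset Γ) (n : ℕ) (f g : H) :
    ⟪(walkOperator π S ^ n) f, g⟫ = ⟪f, (walkOperator π S ^ n) g⟫ := by
  induction n generalizing f g with
  | zero => simp
  | succ n ih =>
    rw [pow_succ, Module.End.mul_apply, ih, inner_walkOperator_left hπ, ← Module.End.mul_apply,
      ← pow_succ', pow_succ]

theorem inner_map_self (hπ : ∀ γ f, ‖π γ f‖ = ‖f‖) (γ : Γ) (f : H) :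
    ⟪f, π γ f⟫ = ‖f‖ ^ 2 - ‖f - π γ f‖ ^ 2 / 2 := by
  rw [@norm_sub_sq_real, hπ]; ring

/-- Laziness makes the image the midpoint of `f` and its symmetric average `p`, with `‖p‖ ≤ ‖f‖`.
Expanding the square leaves `⟪f, p⟫`, which the displacements determine. Without the lazy half,
spectrum near `-1` would obstruct such a bound. -/
theorem norm_walkOperator_sq_le (hπ : ∀ γ f, ‖π γ f‖ = ‖f‖) {S : Finset Γ} (hS : S.Nonempty)
    (f : H) : ‖walkOperator π S f‖ ^ 2 ≤
      ‖f‖ ^ 2 - (4 * (S.card : ℝ))⁻¹ * ∑ s ∈ S, ‖f - π s f‖ ^ 2 := by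
  have hd : (0 : ℝ) < S.card := by exact_mod_cast hS.card_pos
  set p : H := (2 * (S.card : ℝ))⁻¹ • ∑ s ∈ S, (π s f + π s⁻¹ f) with hp
  have h1 : walkOperator π S f = (2⁻¹ : ℝ) • (f + p) := by
    rw [walkOperator_apply, hp, smul_add, smul_smul]; congr 2; field_simp; norm_num
  have h2 : ‖p‖ ≤ ‖f‖ := by
    rw [hp, norm_smul, Real.norm_of_nonneg (by positivity), inv_mul_le_iff₀ (by positivity)]
    refine (norm_sum_le _ _).trans ((Finset.sum_le_card_nsmul _ _ (2 * ‖f‖) fun s _ => ?_).trans ?_)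
    · refine (norm_add_le _ _).trans ?_
      rw [hπ, hπ, two_mul]
    · rw [nsmul_eq_mul]; linarith
  have h3 : ⟪f, p⟫ = ‖f‖ ^ 2 - (2 * (S.card : ℝ))⁻¹ * ∑ s ∈ S, ‖f - π s f‖ ^ 2 := by
    have : ∀ s ∈ S, ⟪f, π s f + π s⁻¹ f⟫ = 2 * ‖f‖ ^ 2 - ‖f - π s f‖ ^ 2 := fun s _ => by
      rw [inner_add_right, ← inner_map_left hπ, real_inner_comm f (π s f), inner_map_self hπ]; ring
    rw [hp, inner_smul_right, inner_sum, Finset.sum_congr rfl this, Finset.sum_sub_distrib,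
      Finset.sum_const, nsmul_eq_mul]
    field_simp
  rw [h1, norm_smul, mul_pow, @norm_add_sq_real, h3, Real.norm_of_nonneg (by norm_num)]
  have h4 : ‖p‖ ^ 2 ≤ ‖f‖ ^ 2 := by gcongr
  have h5 : (2 * (S.card : ℝ))⁻¹ = 2 * (4 * (S.card : ℝ))⁻¹ := by field_simp; norm_num
  rw [h5]
  nlinarith

/-- The displacements by `s` and `s⁻¹` have equal norm, so only elements of `S` are needed. This
converts a contraction into a Poincaré inequality. -/
theorem norm_sub_walkOperator_le (hπ : ∀ γ f, ‖π γ f‖ = ‖f‖) {S : Finset Γ} (hS : S.Nonempty)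
    (f : H) : ‖f - walkOperator π S f‖ ≤ (2 * (S.card : ℝ))⁻¹ * ∑ s ∈ S, ‖f - π s f‖ := by
  have hd : (0 : ℝ) < S.card := by exact_mod_cast hS.card_pos
  have h1 : f - walkOperator π S f =
      (4 * (S.card : ℝ))⁻¹ • ∑ s ∈ S, ((f - π s f) + (f - π s⁻¹ f)) := by
    have : ∑ s ∈ S, ((f - π s f) + (f - π s⁻¹ f)) =
        (2 * (S.card : ℝ)) • f - ∑ s ∈ S, (π s f + π s⁻¹ f) := by
      rw [mul_comm, mul_smul, Nat.cast_smul_eq_nsmul, ← Finset.sum_const, ← Finset.sum_sub_distrib]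
      exact Finset.sum_congr rfl fun s _ => by rw [two_smul]; abel
    rw [this, smul_sub, smul_smul, walkOperator_apply,
      show (4 * (S.card : ℝ))⁻¹ * (2 * S.card) = 2⁻¹ by field_simp; norm_num]
    nth_rw 1 [show f = (2⁻¹ : ℝ) • f + (2⁻¹ : ℝ) • f by rw [← add_smul]; norm_num]
    abel
  have h2 : ∀ s ∈ S, ‖(f - π s f) + (f - π s⁻¹ f)‖ ≤ 2 * ‖f - π s f‖ := fun s _ => by
    refine (norm_add_le _ _).trans ?_
    have : ‖f - π s⁻¹ f‖ = ‖f - π s f‖ := by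
      rw [← hπ s (f - π s⁻¹ f), map_sub, ← Module.End.mul_apply, ← map_mul, mul_inv_cancel,
        map_one, Module.End.one_apply, norm_sub_rev]
    rw [this, two_mul]
  rw [h1, norm_smul, Real.norm_of_nonneg (by positivity)]
  have h3 := (norm_sum_le S _).trans (Finset.sum_le_sum h2)
  rw [← Finset.mul_sum] at h3
  refine (mul_le_mul_of_nonneg_left h3 (by positivity)).trans (le_of_eq ?_)
  field_simp; norm_num

end Representation

/-- A nonnegative log-convex sequence bounded by a geometric one with ratio `ρ` starts with a
quotient of at most `ρ`. -/
theorem le_mul_of_sq_le_of_le_geometric {b : ℕ → ℝ} {ρ C : ℝ} (hρ : 0 < ρ) (hb : ∀ n, 0 ≤ b n)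
    (hlog : ∀ n, b (n + 1) ^ 2 ≤ b n * b (n + 2)) (hC : ∀ n, b n ≤ C * ρ ^ n) :
    b 1 ≤ ρ * b 0 := by
  by_contra! h
  have h0 : 0 < b 0 := by
    refine lt_of_le_of_ne (hb 0) fun h0 => ?_
    have := hlog 0
    rw [← h0] at this h
    simp only [zero_add, zero_mul, mul_zero] at this h
    nlinarith
  set r := b 1 / b 0 with hr
  have hρr : ρ < r := by rw [hr, lt_div_iff₀ h0]; exact h
  have hrpos : 0 < r := hρ.trans hρr
  -- Log-convexity keeps every successive quotient at least the first one, `r`; if `r` exceeded `ρ`,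
  -- the growth would beat the geometric bound.
  have key : ∀ n, 0 < b n ∧ r * b n ≤ b (n + 1) := by
    intro n
    induction n with
    | zero => exact ⟨h0, by rw [hr]; field_simp; rfl⟩
    | succ n ih =>
      have hpos : 0 < b (n + 1) := lt_of_lt_of_le (mul_pos hrpos ih.1) ih.2
      refine ⟨hpos, ?_⟩
      have h1 := hlog n
      have h2 : b n * (r * b (n + 1)) ≤ b n * b (n + 2) := by
        refine le_trans ?_ h1
        nlinarith [ih.2]
      exact le_of_mul_le_mul_left h2 ih.1
  have hgeo : ∀ n, r ^ n * b 0 ≤ b n := by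
    intro n
    induction n with
    | zero => simp
    | succ n ih =>
      rw [pow_succ']
      have := (key n).2
      nlinarith
  have hlt : 1 < r / ρ := by rwa [one_lt_div hρ]
  obtain ⟨n, hn⟩ := pow_unbounded_of_one_lt (C / b 0) hlt
  rw [div_pow, div_lt_div_iff₀ h0 (by positivity)] at hn
  exact absurd ((hgeo n).trans (hC n)) (not_le.mpr hn)

/-- If the coefficients of the powers of the lazy random walk decay at rate `ρ`, then vectors with
finitely supported matrix coefficients are contracted at rate `ρ`. -/
theorem norm_walkOperator_le_of_finite {H : Type*} [NormedAddCommGroup H] [InnerProductSpace ℝ H]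
    {π : Γ →* Module.End ℝ H} (hπ : ∀ γ f, ‖π γ f‖ = ‖f‖) {S : Finset Γ} {ρ : ℝ} (hρ : 0 < ρ)
    (hcoeff : ∀ n γ, |(lazyStep S ^ n).coeff γ| ≤ ρ ^ n) (f : H)
    (hf : {γ | ⟪π γ f, f⟫ ≠ 0}.Finite) : ‖walkOperator π S f‖ ≤ ρ * ‖f‖ := by
  classical
  set b : ℕ → ℝ := fun n => ‖(walkOperator π S ^ n) f‖ with hb
  have hinner : ∀ m n, ⟪(walkOperator π S ^ m) f, (walkOperator π S ^ n) f⟫ =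
      ⟪(walkOperator π S ^ (m + n)) f, f⟫ := fun m n => by
    rw [← inner_walkOperator_pow_left hπ, ← Module.End.mul_apply, ← pow_add, add_comm]
  set K := hf.toFinset with hK
  -- Only the finitely many `γ` in `K` contribute. The prefactor depends on `f` but disappears in
  -- the log-convexity argument, leaving a rate uniform in `f`.
  have hbound : ∀ n, ⟪(walkOperator π S ^ n) f, f⟫ ≤ (K.card * ‖f‖ ^ 2) * ρ ^ n := by
    intro n
    have h1 : walkOperator π S ^ n = MonoidAlgebra.lift ℝ _ Γ π (lazyStep S ^ n) := by
      rw [map_pow]; rfl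
    rw [h1, MonoidAlgebra.lift_apply, Finsupp.sum, LinearMap.sum_apply, sum_inner]
    have h2 : ∀ γ, ⟪((lazyStep S ^ n).coeff γ • π γ) f, f⟫ =
        (lazyStep S ^ n).coeff γ * ⟪π γ f, f⟫ := fun γ => by
      rw [LinearMap.smul_apply, inner_smul_left]; rfl
    rw [Finset.sum_congr rfl fun γ _ => h2 γ]
    have h3 : ∀ γ, (lazyStep S ^ n).coeff γ * ⟪π γ f, f⟫ ≤
        if γ ∈ K then ‖f‖ ^ 2 * ρ ^ n else 0 := by
      intro γ
      split_ifs with hγ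
      · refine (le_abs_self _).trans ?_
        rw [abs_mul, mul_comm]
        refine mul_le_mul ?_ (hcoeff n γ) (abs_nonneg _) (sq_nonneg _)
        refine (abs_real_inner_le_norm _ _).trans ?_
        rw [hπ, sq]
      · have : ⟪π γ f, f⟫ = 0 := by
          by_contra h; exact hγ (by rw [hK, Set.Finite.mem_toFinset]; exact h)
        rw [this, mul_zero]
    refine (Finset.sum_le_sum fun γ _ => h3 γ).trans ?_
    rw [Finset.sum_ite_mem, Finset.sum_const, nsmul_eq_mul, mul_assoc]
    gcongr
    exact Finset.inter_subset_right
  have h := le_mul_of_sq_le_of_le_geometric (b := b) (ρ := ρ) (C := Real.sqrt (K.card * ‖f‖ ^ 2)) hρ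
    (fun n => norm_nonneg _) (fun n => ?_) (fun n => ?_)
  · simpa [hb] using h
  -- Self-adjointness redistributes the `2 * n + 2` factors of the walk; Cauchy–Schwarz then gives
  -- log-convexity.
  · have : b (n + 1) ^ 2 = ⟪(walkOperator π S ^ n) f, (walkOperator π S ^ (n + 2)) f⟫ := by
      rw [hb, ← real_inner_self_eq_norm_sq, hinner, hinner]; congr 3; ring
    rw [this]
    exact real_inner_le_norm _ _
  · have : b n ^ 2 ≤ (K.card * ‖f‖ ^ 2) * (ρ ^ n) ^ 2 := by
      rw [hb, ← real_inner_self_eq_norm_sq, hinner, ← pow_mul, mul_two]; exact hbound _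
    rw [← Real.sqrt_sq (by positivity : 0 ≤ ρ ^ n), ← Real.sqrt_mul (by positivity)]
    exact Real.le_sqrt_of_sq_le this

end SpectralGap

/-! ### Coefficient decay via the right regular representation -/

section Regular

/-- The `ℓ²` inner product on finitely supported functions. -/
abbrev finsuppInnerCore (Γ : Type*) : InnerProductSpace.Core ℝ (Γ →₀ ℝ) where
  inner φ ψ := φ.sum fun x a => a * ψ x
  conj_inner_symm φ ψ := by
    classical
    simp only [conj_trivial]
    rw [Finsupp.sum_of_support_subset ψ (Finset.subset_union_right (s₁ := φ.support)) _ (by simp),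
      Finsupp.sum_of_support_subset φ (Finset.subset_union_left (s₂ := ψ.support)) _ (by simp)]
    exact Finset.sum_congr rfl fun x _ => mul_comm _ _
  re_inner_nonneg φ := Finset.sum_nonneg fun x _ => mul_self_nonneg _
  add_left φ ψ χ := Finsupp.sum_add_index' (by simp) (by intros; ring)
  smul_left φ ψ r := by
    rw [Finsupp.sum_smul_index (by simp), Finsupp.mul_sum]
    simp only [conj_trivial, mul_assoc]
  definite φ h := by
    ext x
    by_contra hx
    have := (Finset.sum_eq_zero_iff_of_nonneg fun x _ => mul_self_nonneg (φ x)).1 h x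
      (Finsupp.mem_support_iff.2 hx)
    exact hx (mul_self_eq_zero.1 this)

/-- The right regular representation on finitely supported functions. -/
def rightRegular (Γ : Type*) [Group Γ] : Γ →* Module.End ℝ (Γ →₀ ℝ) where
  toFun γ := Finsupp.lmapDomain ℝ ℝ (· * γ⁻¹)
  map_one' := by
    ext1 x
    ext1
    simp [Finsupp.lmapDomain_apply, Finsupp.mapDomain_single]
  map_mul' γ η := by
    ext1 x
    ext1
    simp [Finsupp.lmapDomain_apply, Finsupp.mapDomain_single, mul_assoc]

variable {Γ : Type*}

theorem rightRegular_apply [Group Γ] (γ : Γ) (φ : Γ →₀ ℝ) (x : Γ) : rightRegular Γ γ φ x = φ (x * γ) := by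
  have h : Function.Injective (· * γ⁻¹ : Γ → Γ) := mul_left_injective _
  have := Finsupp.mapDomain_apply h φ (x * γ)
  simpa [rightRegular] using this

theorem inner_finsupp_eq_sum (φ ψ : Γ →₀ ℝ) {U : Finset Γ} (hU : φ.support ⊆ U) :
    (finsuppInnerCore Γ).inner φ ψ = ∑ x ∈ U, φ x * ψ x :=
  Finsupp.sum_of_support_subset φ hU _ (by simp)

/-- On a non-amenable Cayley graph the coefficients of the powers of the lazy random walk decay
exponentially. -/
theorem exists_abs_coeff_lazyStep_pow_le [Group Γ] {S : Finset Γ}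
    (hX : IsNonamenable (SimpleGraph.mulCayley (S : Set Γ))) :
    ∃ ρ : ℝ, 0 < ρ ∧ ρ < 1 ∧ ∀ n γ, |(lazyStep S ^ n).coeff γ| ≤ ρ ^ n := by
  classical
  let _ : NormedAddCommGroup (Γ →₀ ℝ) := (finsuppInnerCore Γ).toNormedAddCommGroup
  let _ : InnerProductSpace ℝ (Γ →₀ ℝ) := InnerProductSpace.ofCore (finsuppInnerCore Γ).toCore
  have hS := nonempty_of_isNonamenable_mulCayley hX
  have hd : (0 : ℝ) < S.card := by exact_mod_cast hS.card_pos
  have hin : ∀ φ ψ : Γ →₀ ℝ, ∀ U : Finset Γ, φ.support ⊆ U → ⟪φ, ψ⟫ = ∑ x ∈ U, φ x * ψ x :=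
    fun φ ψ U hU => inner_finsupp_eq_sum φ ψ hU
  have hnorm : ∀ φ : Γ →₀ ℝ, ∀ U : Finset Γ, φ.support ⊆ U → ‖φ‖ ^ 2 = ∑ x ∈ U, φ x ^ 2 :=
    fun φ U hU => by rw [← real_inner_self_eq_norm_sq, hin φ φ U hU]; simp only [sq]
  have hπ : ∀ γ (φ : Γ →₀ ℝ), ‖rightRegular Γ γ φ‖ = ‖φ‖ := by
    intro γ φ
    rw [← sq_eq_sq₀ (norm_nonneg _) (norm_nonneg _), hnorm φ _ le_rfl,
      hnorm (rightRegular Γ γ φ) (φ.support.image (· * γ⁻¹)) fun x hx => ?_,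
      Finset.sum_image fun x _ y _ h => mul_right_cancel h]
    · simp [rightRegular_apply]
    · rw [Finsupp.mem_support_iff, rightRegular_apply] at hx
      exact Finset.mem_image.2 ⟨x * γ, Finsupp.mem_support_iff.2 hx, by simp⟩
  set h := edgeIsoperimetricConstant (SimpleGraph.mulCayley (S : Set Γ)) with hh
  have hpos : 0 < h := hX
  have hpoinc : ∀ φ : Γ →₀ ℝ, h ^ 2 / (4 * S.card) * ‖φ‖ ^ 2 ≤
      ∑ s ∈ S, ‖φ - rightRegular Γ s φ‖ ^ 2 := by
    intro φ
    set U := φ.support ∪ S.biUnion fun s => φ.support.image (· * s⁻¹) with hU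
    have hUS : ∀ s ∈ S, ∀ x, φ (x * s) ≠ 0 → x ∈ U := fun s hs x hx =>
      Finset.mem_union_right _ (Finset.mem_biUnion.2 ⟨s, hs, Finset.mem_image.2
        ⟨x * s, Finsupp.mem_support_iff.2 hx, by simp⟩⟩)
    have hU0 : ∀ x, φ x ≠ 0 → x ∈ U := fun x hx =>
      Finset.mem_union_left _ (Finsupp.mem_support_iff.2 hx)
    have := edgeIsoperimetricConstant_sq_mul_sum_sq_le S U φ hX hS hU0 hUS
    rw [hnorm φ U Finset.subset_union_left]
    refine this.trans (Finset.sum_le_sum fun s hs => le_of_eq ?_)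
    rw [hnorm _ U fun x hx => ?_]
    · refine Finset.sum_congr rfl fun x _ => ?_
      rw [Finsupp.sub_apply, rightRegular_apply]; ring
    · rw [Finsupp.mem_support_iff, Finsupp.sub_apply, rightRegular_apply] at hx
      by_cases h1 : φ x = 0
      · exact hUS s hs x fun h2 => hx (by rw [h1, h2, sub_zero])
      · exact hU0 x h1
  -- Capping at `1 / 2` keeps `1 - κ` positive, hence `ρ` as well.
  set κ := min ((4 * (S.card : ℝ))⁻¹ * (h ^ 2 / (4 * S.card))) (1 / 2) with hκ
  have hκ0 : 0 < κ := lt_min (by positivity) (by norm_num)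
  have hκ1 : κ ≤ 1 / 2 := min_le_right _ _
  set ρ := Real.sqrt (1 - κ) with hρ
  have hρ0 : 0 < ρ := Real.sqrt_pos.2 (by linarith)
  have hstep : ∀ φ : Γ →₀ ℝ, ‖walkOperator (rightRegular Γ) S φ‖ ≤ ρ * ‖φ‖ := by
    intro φ
    refine (sq_le_sq₀ (norm_nonneg _) (by positivity)).1 ?_
    rw [mul_pow, hρ, Real.sq_sqrt (by linarith)]
    have h1 := norm_walkOperator_sq_le hπ hS φ
    have h2 := mul_le_mul_of_nonneg_left (hpoinc φ) (show 0 ≤ (4 * (S.card : ℝ))⁻¹ by positivity)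
    have h3 := mul_le_mul_of_nonneg_right
      (min_le_left ((4 * (S.card : ℝ))⁻¹ * (h ^ 2 / (4 * S.card))) (1 / 2)) (sq_nonneg ‖φ‖)
    rw [← hκ] at h3
    linarith
  have hpow : ∀ n, ‖(walkOperator (rightRegular Γ) S ^ n) (Finsupp.single 1 1)‖ ≤ ρ ^ n := by
    intro n
    induction n with
    | zero =>
      have := hnorm (Finsupp.single (1 : Γ) (1 : ℝ)) {1} Finsupp.support_single_subset
      simp only [Finset.sum_singleton, Finsupp.single_eq_same] at this
      simp only [pow_zero, Module.End.one_apply]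
      nlinarith [norm_nonneg (Finsupp.single (1 : Γ) (1 : ℝ))]
    | succ n ih =>
      rw [pow_succ', pow_succ', Module.End.mul_apply]
      exact (hstep _).trans (mul_le_mul_of_nonneg_left ih hρ0.le)
  refine ⟨ρ, hρ0, ?_, fun n γ => ?_⟩
  · rw [hρ, Real.sqrt_lt' one_pos]; linarith
  -- The coefficients are the values of the walk applied to the point mass at the identity, so its
  -- `ℓ²` norm bounds each of them; right translation by `γ` accounts for the inverse.
  have hco : ((walkOperator (rightRegular Γ) S ^ n) (Finsupp.single 1 1)) γ⁻¹ =
      (lazyStep S ^ n).coeff γ := by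
    have h1 : walkOperator (rightRegular Γ) S ^ n =
        MonoidAlgebra.lift ℝ _ Γ (rightRegular Γ) (lazyStep S ^ n) := by rw [map_pow]; rfl
    rw [h1, MonoidAlgebra.lift_apply, Finsupp.sum, LinearMap.sum_apply, Finsupp.finsetSum_apply]
    simp only [LinearMap.smul_apply, Finsupp.smul_apply, rightRegular_apply, Finsupp.single_apply]
    rw [Finset.sum_eq_single γ]
    · simp
    · intro η _ hη
      rw [if_neg, smul_zero]
      intro h; exact hη (inv_mul_eq_one.1 h.symm).symm
    · intro hγ; rw [Finsupp.notMem_support_iff.1 hγ, zero_smul]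
  rw [← hco]
  refine le_trans ?_ (hpow n)
  set ψ := (walkOperator (rightRegular Γ) S ^ n) (Finsupp.single 1 1)
  refine abs_le_of_sq_le_sq ?_ (norm_nonneg _)
  rw [hnorm ψ (insert γ⁻¹ ψ.support) (Finset.subset_insert _ _)]
  exact Finset.single_le_sum (f := fun x => ψ x ^ 2) (fun x _ => sq_nonneg _)
    (Finset.mem_insert_self _ _)

end Regular

/-- Vectors with finitely supported matrix coefficients under a unitary representation of a
non-amenable group satisfy a Poincaré inequality. -/
theorem one_sub_mul_norm_le_sum_norm_sub {Γ : Type*} [Group Γ] {H : Type*} [NormedAddCommGroup H]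
    [InnerProductSpace ℝ H] {π : Γ →* Module.End ℝ H} (hπ : ∀ γ f, ‖π γ f‖ = ‖f‖) {S : Finset Γ}
    (hS : S.Nonempty) {ρ : ℝ} (hρ : 0 < ρ)
    (hcoeff : ∀ n γ, |(lazyStep S ^ n).coeff γ| ≤ ρ ^ n) (f : H)
    (hf : {γ | ⟪π γ f, f⟫ ≠ 0}.Finite) :
    (1 - ρ) * ‖f‖ ≤ (2 * (S.card : ℝ))⁻¹ * ∑ s ∈ S, ‖f - π s f‖ := by
  have h1 := norm_walkOperator_le_of_finite hπ hρ hcoeff f hf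
  have h2 := norm_sub_walkOperator_le hπ hS f
  have h3 := norm_sub_norm_le f (walkOperator π S f)
  linarith

/-! ### Shifts of the randomness: spectral gap and mixing -/

section Shift

instance isProbabilityMeasure_law (V : Type*) : IsProbabilityMeasure (law V) := by
  unfold law; infer_instance

variable {V : Type*}

/-- The centered indicator function of an event. -/
def centered (A : Set (Randomness V)) (hA : MeasurableSet A) : Lp ℝ 2 (law V) :=
  indicatorConstLp 2 hA (measure_ne_top _ _) (1 : ℝ) -
    (law V).real A • indicatorConstLp 2 MeasurableSet.univ (measure_ne_top _ _) (1 : ℝ)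

theorem inner_centered {A B : Set (Randomness V)} (hA : MeasurableSet A) (hB : MeasurableSet B) :
    ⟪centered A hA, centered B hB⟫ =
      (law V).real (A ∩ B) - (law V).real A * (law V).real B := by
  simp only [centered, inner_sub_left, inner_sub_right, inner_smul_left, inner_smul_right,
    L2.real_inner_indicatorConstLp_one_indicatorConstLp_one, conj_trivial, inter_univ, univ_inter,
    probReal_univ]
  ring

theorem law_real_symmDiff {A B : Set (Randomness V)} (hA : MeasurableSet A)
    (hB : MeasurableSet B) : (law V).real (symmDiff A B) =
      (law V).real A + (law V).real B - 2 * (law V).real (A ∩ B) := by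
  rw [measureReal_symmDiff_eq hA hB]
  have h1 := measureReal_sdiff_add_inter (μ := law V) (s := A) hB
  have h2 := measureReal_sdiff_add_inter (μ := law V) (s := B) hA
  rw [inter_comm] at h2
  linarith

theorem norm_centered_sq {A : Set (Randomness V)} (hA : MeasurableSet A) :
    ‖centered A hA‖ ^ 2 = (law V).real A * (1 - (law V).real A) := by
  rw [← real_inner_self_eq_norm_sq, inner_centered, inter_self]; ring

theorem norm_centered_sub_centered_sq {A B : Set (Randomness V)} (hA : MeasurableSet A)
    (hB : MeasurableSet B) : ‖centered A hA - centered B hB‖ ^ 2 =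
      (law V).real (symmDiff A B) - ((law V).real A - (law V).real B) ^ 2 := by
  rw [@norm_sub_sq_real, norm_centered_sq, norm_centered_sq, inner_centered,
    law_real_symmDiff hA hB]
  ring

/-- The centered indicator functions of cylinder events. -/
def cylinderVectors (V : Type*) : Set (Lp ℝ 2 (law V)) :=
  {f | ∃ (F : Finset V) (T : Set (∀ _ : F, I × I × I)) (hT : MeasurableSet T),
    f = centered (cylinder F T) (MeasurableSet.cylinder F hT)}

/-- Cylinders form a ring generating the σ-algebra, so they approximate `A` in symmetric difference,
which bounds the squared `L²` distance of the centered indicators. -/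
theorem centered_mem_closure_cylinderVectors {A : Set (Randomness V)} (hA : MeasurableSet A) :
    centered A hA ∈ closure (cylinderVectors V) := by
  rw [Metric.mem_closure_iff]
  intro ε hε
  obtain ⟨t, ht, hlt⟩ := exists_measure_symmDiff_lt_of_generateFrom_isSetRing (μ := law V)
    (C := measurableCylinders fun _ : V => I × I × I)
    isSetRing_measurableCylinders
    ⟨{univ}, countable_singleton _, by simpa using univ_mem_measurableCylinders (fun _ : V => I × I × I), by simp⟩
    generateFrom_measurableCylinders.symm hA (ε := ENNReal.ofReal (ε ^ 2)) (ENNReal.ofReal_pos.2 (by positivity))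
  obtain ⟨F, T, hT, rfl⟩ := (mem_measurableCylinders _).1 ht
  refine ⟨_, ⟨F, T, hT, rfl⟩, ?_⟩
  rw [dist_eq_norm, norm_sub_rev]
  refine lt_of_pow_lt_pow_left₀ 2 hε.le ?_
  rw [norm_centered_sub_centered_sq]
  have : (law V).real (symmDiff (cylinder F T) A) < ε ^ 2 := by
    rw [measureReal_def]
    exact (ENNReal.lt_ofReal_iff_toReal_lt (measure_ne_top _ _)).1 hlt
  nlinarith [sq_nonneg ((law V).real (cylinder F T) - (law V).real A)]

variable [Group V]

/-- The shift of the randomness by a group element. -/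
def shift (g : V) (x : Randomness V) : Randomness V := fun v => x (g * v)

theorem measurable_shift (g : V) : Measurable (shift g) := by
  unfold shift; fun_prop

theorem measurePreserving_shift (g : V) : MeasurePreserving (shift g) (law V) (law V) :=
  ⟨measurable_shift g, Measure.map_infinitePi_infinitePi_of_inj
    (P := fun _ : V => (volume : Measure (I × I × I))) (mul_right_injective g)⟩

theorem law_real_preimage_shift (g : V) {A : Set (Randomness V)} (hA : MeasurableSet A) :
    (law V).real (shift g ⁻¹' A) = (law V).real A :=
  (measurePreserving_shift g).measureReal_preimage hA.nullMeasurableSet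

open Classical in
/-- Cylinder events with disjoint supports are independent. -/
theorem law_real_inter_preimage_shift (g : V) (F : Finset V) {T : Set (∀ _ : F, I × I × I)}
    (hT : MeasurableSet T) (hd : Disjoint F (F.image (g * ·))) :
    (law V).real (shift g ⁻¹' (cylinder F T) ∩ cylinder F T) =
      (law V).real (cylinder F T) * (law V).real (cylinder F T) := by
  have hA : MeasurableSet (cylinder F T : Set (Randomness V)) :=
    MeasurableSet.cylinder F hT
  have hind : ProbabilityTheory.iIndepFun (fun v (x : Randomness V) => x v) (law V) :=
    ProbabilityTheory.iIndepFun_infinitePi (P := fun _ : V => (volume : Measure (I × I × I)))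
      (X := fun _ y => y) fun _ => measurable_id
  have h := hind.indepFun_finset F (F.image (g * ·)) hd fun v => measurable_pi_apply v
  set r : (∀ _ : F.image (g * ·), I × I × I) → (∀ _ : F, I × I × I) :=
    fun y i => y ⟨g * i, Finset.mem_image_of_mem _ i.2⟩ with hr
  have hrm : Measurable r := by rw [hr]; fun_prop
  have h1 := h.measure_inter_preimage_eq_mul T (r ⁻¹' T) hT (hrm hT)
  have e1 : (fun (x : Randomness V) (i : F) => x i) ⁻¹' T = cylinder F T := rfl
  have e2 : (fun (x : Randomness V) (i : F.image (g * ·)) => x i) ⁻¹' (r ⁻¹' T) =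
    shift g ⁻¹' (cylinder F T) := rfl
  rw [e1, e2] at h1
  rw [inter_comm, measureReal_def, h1, ENNReal.toReal_mul, ← measureReal_def, ← measureReal_def,
    law_real_preimage_shift g hA]

/-- All but finitely many translates by a subgroup move a finite set off itself. -/
theorem finite_setOf_not_disjoint_image {Γ : Type*} [Group Γ] [DecidableEq V] {ι : Γ →* V}
    (hι : Function.Injective ι) (F : Finset V) :
    {γ | ¬ Disjoint F (F.image (ι γ * ·))}.Finite := by
  refine ((F ×ˢ F).image fun q => q.1 * q.2⁻¹).finite_toSet.preimage hι.injOn |>.subset ?_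
  intro γ hγ
  rw [Set.mem_ofPred_eq, Finset.not_disjoint_iff] at hγ
  obtain ⟨v, hv, hv'⟩ := hγ
  obtain ⟨w, hw, rfl⟩ := Finset.mem_image.1 hv'
  exact Finset.mem_coe.2 (Finset.mem_image.2
    ⟨(ι γ * w, w), Finset.mem_product.2 ⟨hv, hw⟩, by simp⟩)

/-- The Koopman representation. -/
def koopman {Γ : Type*} [Group Γ] (ι : Γ →* V) : Γ →* Module.End ℝ (Lp ℝ 2 (law V)) where
  toFun γ := Lp.compMeasurePreservingₗ ℝ (shift (ι γ)) (measurePreserving_shift _)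
  map_one' := by
    ext1 f
    have h : shift (ι (1 : Γ)) = id := by ext x v : 2; simp [shift]
    refine Lp.ext ((Lp.coeFn_compMeasurePreserving f (measurePreserving_shift (ι 1))).trans ?_)
    rw [h]; rfl
  map_mul' γ η := by
    ext1 f
    -- Shifting reverses products, and so does precomposition; together they give a homomorphism.
    have h : shift (ι (γ * η)) = shift (ι η) ∘ shift (ι γ) := by
      ext x v : 2; simp [shift, mul_assoc]
    refine Lp.ext ((Lp.coeFn_compMeasurePreserving f (measurePreserving_shift (ι (γ * η)))).trans ?_)
    rw [h, ← Function.comp_assoc]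
    have h1 := Lp.coeFn_compMeasurePreserving f (measurePreserving_shift (ι η))
    have h2 := Lp.coeFn_compMeasurePreserving
      (Lp.compMeasurePreserving (shift (ι η)) (measurePreserving_shift _) f)
      (measurePreserving_shift (ι γ))
    exact ((measurePreserving_shift (ι γ)).quasiMeasurePreserving.ae_eq h1).symm.trans h2.symm

variable {Γ : Type*} [Group Γ] (ι : Γ →* V)

theorem norm_koopman (γ : Γ) (f : Lp ℝ 2 (law V)) : ‖koopman ι γ f‖ = ‖f‖ :=
  Lp.norm_compMeasurePreserving f (measurePreserving_shift _)

theorem koopman_centered (γ : Γ) {A : Set (Randomness V)} (hA : MeasurableSet A) :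
    koopman ι γ (centered A hA) =
      centered (shift (ι γ) ⁻¹' A) (measurable_shift _ hA) := by
  unfold centered
  rw [map_sub, map_smul, law_real_preimage_shift _ hA]
  rfl

/-- The matrix coefficient is the covariance of a cylinder event with its translate, which vanishes
by independence once the supporting finite sets are disjoint. -/
theorem finite_inner_koopman_ne_zero (hι : Function.Injective ι) {f : Lp ℝ 2 (law V)}
    (hf : f ∈ cylinderVectors V) : {γ | ⟪koopman ι γ f, f⟫ ≠ 0}.Finite := by
  classical
  obtain ⟨F, T, hT, rfl⟩ := hf
  refine (finite_setOf_not_disjoint_image hι F).subset fun γ hγ hd => hγ ?_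
  rw [koopman_centered, inner_centered, law_real_inter_preimage_shift _ F hT hd,
    law_real_preimage_shift _ (MeasurableSet.cylinder F hT), sub_self]

theorem continuous_koopman (γ : Γ) : Continuous (koopman ι γ) :=
  (AddMonoidHomClass.isometry_of_norm (koopman ι γ) (norm_koopman ι γ)).continuous

theorem norm_centered_sub_koopman_sq (γ : Γ) {A : Set (Randomness V)} (hA : MeasurableSet A) :
    ‖centered A hA - koopman ι γ (centered A hA)‖ ^ 2 =
      (law V).real (symmDiff A (shift (ι γ) ⁻¹' A)) := by
  rw [koopman_centered, norm_centered_sub_centered_sq, law_real_preimage_shift _ hA]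
  ring

/-- Events that are almost invariant under a non-amenable group of shifts are almost trivial. -/
theorem exists_law_real_mul_le_of_isNonamenable (hι : Function.Injective ι) {S : Finset Γ}
    (hX : IsNonamenable (SimpleGraph.mulCayley (S : Set Γ))) :
    ∃ C : ℝ, 0 < C ∧ ∀ (A : Set (Randomness V)) (δ : ℝ), MeasurableSet A → 0 ≤ δ →
      (∀ s ∈ S, (law V).real (symmDiff A (shift (ι s) ⁻¹' A)) ≤ δ) →
      (law V).real A * (1 - (law V).real A) ≤ C * δ := by
  obtain ⟨ρ, hρ0, hρ1, hcoeff⟩ := exists_abs_coeff_lazyStep_pow_le hX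
  have hS := nonempty_of_isNonamenable_mulCayley hX
  have hd : (0 : ℝ) < S.card := by exact_mod_cast hS.card_pos
  have h1ρ : 0 < 1 - ρ := by linarith
  refine ⟨(4 * (1 - ρ) ^ 2)⁻¹, by positivity, fun A δ hA hδ h => ?_⟩
  -- The Poincaré constant does not depend on `f`, so the inequality is a closed condition and
  -- extends from cylinder events to `A`.
  have hclosed : IsClosed {f : Lp ℝ 2 (law V) |
      (1 - ρ) * ‖f‖ ≤ (2 * (S.card : ℝ))⁻¹ * ∑ s ∈ S, ‖f - koopman ι s f‖} := by
    refine isClosed_le (by fun_prop) (continuous_const.mul (continuous_finsetSum _ fun s _ => ?_))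
    exact (continuous_id.sub (continuous_koopman ι s)).norm
  have hA' := hclosed.closure_subset_iff.2 (fun f hf => one_sub_mul_norm_le_sum_norm_sub
    (norm_koopman ι) hS hρ0 hcoeff f (finite_inner_koopman_ne_zero ι hι hf))
    (centered_mem_closure_cylinderVectors hA)
  rw [Set.mem_ofPred_eq] at hA'
  have h2 : ∀ s ∈ S, ‖centered A hA - koopman ι s (centered A hA)‖ ≤ Real.sqrt δ := fun s hs =>
    Real.le_sqrt_of_sq_le ((norm_centered_sub_koopman_sq ι s hA).trans_le (h s hs))
  have h3 : (1 - ρ) * ‖centered A hA‖ ≤ Real.sqrt δ / 2 := by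
    refine hA'.trans ((mul_le_mul_of_nonneg_left (Finset.sum_le_sum h2) (by positivity)).trans ?_)
    rw [Finset.sum_const, nsmul_eq_mul]
    apply le_of_eq; field_simp
  have h4 := pow_le_pow_left₀ (by positivity) h3 2
  rw [mul_pow, div_pow, Real.sq_sqrt hδ, norm_centered_sq] at h4
  rw [inv_mul_eq_div, le_div_iff₀ (by positivity)]
  linarith

/-- Events that are almost invariant under an infinite group of shifts are almost trivial. -/
theorem law_real_mul_le_of_infinite [Infinite Γ] (hι : Function.Injective ι)
    {A : Set (Randomness V)} {δ : ℝ} (hA : MeasurableSet A) (hδ : 0 ≤ δ)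
    (h : ∀ γ, (law V).real (symmDiff A (shift (ι γ) ⁻¹' A)) ≤ δ) :
    (law V).real A * (1 - (law V).real A) ≤ δ := by
  set f := centered A hA
  have h2 : ∀ γ, ‖f - koopman ι γ f‖ ≤ Real.sqrt δ := fun γ =>
    Real.le_sqrt_of_sq_le ((norm_centered_sub_koopman_sq ι γ hA).trans_le (h γ))
  have key : ‖f‖ ≤ Real.sqrt δ := by
    refine le_of_forall_pos_le_add fun ε hε => ?_
    obtain ⟨g, hg, hfg⟩ := Metric.mem_closure_iff.1 (centered_mem_closure_cylinderVectors hA)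
      (ε / 3) (by positivity)
    rw [dist_eq_norm] at hfg
    -- An infinite group contains a shift making `g` orthogonal to its translate, so `g` is
    -- displaced by at least its own norm, whereas `f` moves by at most `√δ`.
    obtain ⟨γ, hγ⟩ := (finite_inner_koopman_ne_zero ι hι hg).exists_notMem
    rw [Set.mem_ofPred_eq, not_not] at hγ
    have h3 : ‖g‖ ≤ ‖g - koopman ι γ g‖ := by
      refine (sq_le_sq₀ (norm_nonneg _) (norm_nonneg _)).1 ?_
      rw [@norm_sub_sq_real, real_inner_comm, hγ]
      nlinarith [sq_nonneg ‖koopman ι γ g‖]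
    have h4 : g - koopman ι γ g = (f - koopman ι γ f) + (koopman ι γ (f - g) - (f - g)) := by
      rw [map_sub]; abel
    have h5 : ‖koopman ι γ (f - g) - (f - g)‖ ≤ 2 * ‖f - g‖ :=
      (norm_sub_le _ _).trans (by rw [norm_koopman, two_mul])
    have h6 := norm_add_le (f - koopman ι γ f) (koopman ι γ (f - g) - (f - g))
    rw [← h4] at h6
    have h7 := norm_sub_norm_le f g
    have h8 := h2 γ
    change ‖f - g‖ < ε / 3 at hfg
    linarith
  have h4 := pow_le_pow_left₀ (norm_nonneg _) key 2
  rwa [Real.sq_sqrt hδ, norm_centered_sq] at h4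

end Shift

/-! ### Finite balls and countability -/

section LocallyFinite

variable {V : Type*} {G : SimpleGraph V}

theorem finite_setOf_walk_length_eq (hG : ∀ v, {w | G.Adj v w}.Finite) (n : ℕ) (u : V) :
    {w | ∃ q : G.Walk u w, q.length = n}.Finite := by
  induction n generalizing u with
  | zero =>
    refine (finite_singleton u).subset ?_
    rintro w ⟨q, hq⟩
    exact (SimpleGraph.Walk.eq_of_length_eq_zero hq).symm
  | succ n ih =>
    refine ((hG u).biUnion fun v _ => ih v).subset ?_
    rintro w ⟨q, hq⟩
    cases q with
    | nil => simp at hq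
    | cons h q => exact mem_biUnion h ⟨q, by simpa using hq⟩

theorem finite_ball (hG : ∀ v, {w | G.Adj v w}.Finite) (hc : G.Connected) (u : V) (R : ℝ) :
    (ball G u R).Finite := by
  refine ((finite_le_nat ⌊R⌋₊).biUnion fun n _ => finite_setOf_walk_length_eq hG n u).subset ?_
  intro w hw
  obtain ⟨q, hq⟩ := hc.exists_walk_length_eq_dist u w
  exact mem_biUnion (x := G.dist u w) (Nat.le_floor hw) ⟨q, hq⟩

theorem countable_of_locallyFinite (hG : ∀ v, {w | G.Adj v w}.Finite) (hc : G.Connected) :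
    Countable V := by
  obtain ⟨u⟩ := hc.nonempty
  rw [← countable_univ_iff]
  refine (countable_iUnion fun n => (finite_setOf_walk_length_eq hG n u).countable).mono ?_
  intro w _
  obtain ⟨q, hq⟩ := hc.exists_walk_length_eq_dist u w
  exact mem_iUnion.2 ⟨_, q, hq⟩

end LocallyFinite

/-! ### Good vertices and the linking relation -/

section Linked

variable {V : Type*} {G : SimpleGraph V} {ω : Set V} {R : ℝ} {u v w : V}

theorem ConnectedIn.symm (h : ConnectedIn G ω u v) : ConnectedIn G ω v u := by
  obtain ⟨q, hq⟩ := h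
  exact ⟨q.reverse, fun x hx => hq x (by simpa using hx)⟩

theorem ConnectedIn.trans (h : ConnectedIn G ω u v) (h' : ConnectedIn G ω v w) :
    ConnectedIn G ω u w := by
  obtain ⟨q, hq⟩ := h
  obtain ⟨q', hq'⟩ := h'
  refine ⟨q.append q', fun x hx => ?_⟩
  rw [SimpleGraph.Walk.mem_support_append_iff] at hx
  exact hx.elim (hq x) (hq' x)

theorem ConnectedIn.mono {ω' : Set V} (hω : ω ⊆ ω') (h : ConnectedIn G ω u v) :
    ConnectedIn G ω' u v :=
  h.imp fun _ hq x hx => hω (hq x hx)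

/-- Vertices are connected to all vertices in a ball around them that is contained in `ω`. -/
theorem connectedIn_of_ball_subset (hc : G.Connected) (hω : ball G u R ⊆ ω) (hv : v ∈ ball G u R) :
    ConnectedIn G ω u v := by
  obtain ⟨q, hq⟩ := hc.exists_walk_length_eq_dist u v
  refine ⟨q, fun x hx => hω ?_⟩
  obtain ⟨q₁, q₂, rfl⟩ := SimpleGraph.Walk.mem_support_iff_exists_append.1 hx
  have h1 := SimpleGraph.dist_le q₁
  rw [SimpleGraph.Walk.length_append] at hq
  have h2 : (G.dist u x : ℝ) ≤ G.dist u v := by exact_mod_cast (by omega)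
  exact h2.trans hv

/-- Two vertices are linked if both are good and the configuration near one of them is connected
to the configuration near the other one. -/
def Linked (G : SimpleGraph V) (R : ℝ) (u v : V) (ω : Set V) : Prop :=
  IsGood G R u ω ∧ IsGood G R v ω ∧
    ∃ a ∈ ω ∩ ball G u R, ∃ b ∈ ω ∩ ball G v R, ConnectedIn G ω a b

theorem Linked.symm (h : Linked G R u v ω) : Linked G R v u ω := by
  obtain ⟨h1, h2, a, ha, b, hb, h⟩ := h
  exact ⟨h2, h1, b, hb, a, ha, h.symm⟩

theorem IsGood.connectedIn (h : IsGood G R u ω) (hv : v ∈ ω ∩ ball G u (3 * R))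
    (hw : w ∈ ω ∩ ball G u (3 * R)) : ConnectedIn G ω v w := by
  obtain ⟨-, c, -, hc⟩ := h
  exact ConnectedIn.trans (ConnectedIn.symm (hc hv)) (hc hw)

theorem ball_subset_ball_three_mul (hR : 0 < R) : ball G u R ⊆ ball G u (3 * R) :=
  fun _ h => le_trans (α := ℝ) h (by linarith)

/-- Goodness of the middle vertex `v` joins the two clusters: both meet its `R`-ball, where only one
cluster is present. -/
theorem Linked.trans (hR : 0 < R) (h : Linked G R u v ω) (h' : Linked G R v w ω) :
    Linked G R u w ω := by
  obtain ⟨h1, h2, a, ha, b, hb, h⟩ := h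
  obtain ⟨-, h3, c, hc, d, hd, h'⟩ := h'
  exact ⟨h1, h3, a, ha, d, hd, (h.trans (h2.connectedIn
    ⟨hb.1, ball_subset_ball_three_mul hR hb.2⟩ ⟨hc.1, ball_subset_ball_three_mul hR hc.2⟩)).trans h'⟩

/-- Good vertices that are adjacent or equal are linked. -/
theorem linked_of_isGood (hc : G.Connected) (hR : 0 < R) (hu : IsGood G R u ω)
    (hv : IsGood G R v ω) (huv : u = v ∨ G.Adj u v) : Linked G R u v ω := by
  obtain ⟨a, ha⟩ := hu.1
  obtain ⟨b, hb⟩ := hv.1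
  refine ⟨hu, hv, a, ha, b, hb, ?_⟩
  rcases huv with rfl | huv
  · exact hu.connectedIn ⟨ha.1, ball_subset_ball_three_mul hR ha.2⟩
      ⟨hb.1, ball_subset_ball_three_mul hR hb.2⟩
  -- The `3 * R`-ball of `u` contains the `R`-ball of a neighbour only if `R + 1 ≤ 3 * R`. For
  -- smaller `R` the `R`-balls are singletons, and the edge itself connects.
  rcases lt_or_ge R (1 / 2) with hR2 | hR2
  · have key : ∀ {x y : V}, y ∈ ball G x R → y = x := fun {x y} h => by
      have h1 : (G.dist x y : ℝ) < 1 := lt_of_le_of_lt h (by linarith)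
      have h2 : G.dist x y = 0 := by
        have : G.dist x y < 1 := by exact_mod_cast h1
        omega
      exact ((hc x y).dist_eq_zero_iff.1 h2).symm
    rw [key ha.2, key hb.2]
    refine ⟨huv.toWalk, fun x hx => ?_⟩
    simp only [SimpleGraph.Adj.toWalk, SimpleGraph.Walk.support_cons,
      SimpleGraph.Walk.support_nil, List.mem_cons, List.not_mem_nil, or_false] at hx
    rcases hx with rfl | rfl
    · rw [← key ha.2]; exact ha.1
    · rw [← key hb.2]; exact hb.1
  · refine hu.connectedIn ⟨ha.1, ball_subset_ball_three_mul hR ha.2⟩ ⟨hb.1, ?_⟩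
    have h1 : (G.dist u b : ℝ) ≤ G.dist u v + G.dist v b := by
      exact_mod_cast hc.dist_triangle
    have h2 : (G.dist v b : ℝ) ≤ R := hb.2
    rw [SimpleGraph.dist_eq_one_iff_adj.2 huv, Nat.cast_one] at h1
    exact le_trans (α := ℝ) h1 (by linarith)

/-- Linked vertices are connected once balls around them are added to the configuration. -/
theorem Linked.connectedIn_of_subset (hc : G.Connected) {ω' : Set V} (h : Linked G R u v ω)
    (hω : ω ⊆ ω') (hu : ball G u R ⊆ ω') (hv : ball G v R ⊆ ω') : ConnectedIn G ω' u v := by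
  obtain ⟨-, -, a, ha, b, hb, h⟩ := h
  exact ((connectedIn_of_ball_subset hc hu ha.2).trans (h.mono hω)).trans
    (connectedIn_of_ball_subset hc hv hb.2).symm

end Linked

/-! ### Measurability -/

section Measurability

variable {V : Type*} [Countable V] (G : SimpleGraph V)

instance countable_walk (u v : V) : Countable (G.Walk u v) :=
  SimpleGraph.Walk.support_injective.countable

theorem measurable_connectedIn (u v : V) : Measurable fun ω : Set V => ConnectedIn G ω u v := by
  unfold ConnectedIn
  exact Measurable.exists fun q => Measurable.forall fun x => measurable_const.imp
    (measurable_set_mem x)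

theorem measurable_isGood (R : ℝ) (v : V) : Measurable fun ω : Set V => IsGood G R v ω := by
  unfold IsGood Set.Nonempty
  refine Measurable.and (Measurable.exists fun x => (measurable_set_mem x).and measurable_const)
    (Measurable.exists fun u => (measurable_set_mem u).and ?_)
  refine Measurable.forall (p := fun x ω => x ∈ ω ∩ ball G v (3 * R) → x ∈ cluster G ω u) fun x => ?_
  exact ((measurable_set_mem x).and measurable_const).imp (measurable_connectedIn G u x)

theorem measurable_linked (R : ℝ) (u v : V) : Measurable fun ω : Set V => Linked G R u v ω := by
  unfold Linked
  refine (measurable_isGood G R u).and ((measurable_isGood G R v).and ?_)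
  exact Measurable.exists fun a => ((measurable_set_mem a).and measurable_const).and
    (Measurable.exists fun b => ((measurable_set_mem b).and measurable_const).and
      (measurable_connectedIn G a b))

theorem measurable_percolation (lam p : ℝ) : Measurable (percolation G lam p) := by
  rw [measurable_set_iff]
  intro v
  have h1 : ∀ c : V, Measurable fun x : Randomness V => c ∈ points lam x := fun c => by
    refine measurableSet_setOfPred.1 (measurableSet_le (f := fun x : Randomness V => ((x c).1 : ℝ))
      ?_ measurable_const)
    fun_prop
  have h2 : ∀ c : V, Measurable fun x : Randomness V => ((x c).2.2 : ℝ) ≤ p := fun c => by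
    refine measurableSet_setOfPred.1 (measurableSet_le ?_ measurable_const)
    fun_prop
  have h3 : ∀ c c' : V, Measurable fun x : Randomness V => label x c < label x c' := fun c c' => by
    refine measurableSet_setOfPred.1 (measurableSet_lt ?_ ?_) <;> unfold label <;> fun_prop
  simp only [percolation, mem_iUnion, exists_prop]
  refine Measurable.exists fun c => ((h1 c).and (h2 c)).and ?_
  exact Measurable.forall fun c' => (h1 c').imp (measurable_const.imp
    (measurable_const.or (measurable_const.and (h3 c c'))))

end Measurability

/-! ### Equivariance under left translations -/

section Invariance

variable {V : Type*} [Group V] {G : SimpleGraph V}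

/-- Left multiplication as an automorphism of an invariant graph. -/
def mulLeftIso (hG : ∀ g u v, G.Adj (g * u) (g * v) ↔ G.Adj u v) (g : V) : G ≃g G where
  toEquiv := Equiv.mulLeft g
  map_rel_iff' := hG g _ _

variable (hG : ∀ g u v, G.Adj (g * u) (g * v) ↔ G.Adj u v)
include hG

theorem dist_mul_left (hc : G.Connected) (g u v : V) : G.dist (g * u) (g * v) = G.dist u v := by
  have key : ∀ g u v : V, G.dist (g * u) (g * v) ≤ G.dist u v := fun g u v => by
    obtain ⟨q, hq⟩ := hc.exists_walk_length_eq_dist u v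
    have := SimpleGraph.dist_le (q.map (mulLeftIso hG g).toHom)
    rw [SimpleGraph.Walk.length_map, hq] at this
    exact this
  refine le_antisymm (key g u v) ?_
  simpa using key g⁻¹ (g * u) (g * v)

theorem mem_ball_mul_left (hc : G.Connected) (g u v : V) (R : ℝ) :
    g * v ∈ ball G (g * u) R ↔ v ∈ ball G u R := by
  simp only [ball, Set.mem_ofPred_eq, dist_mul_left hG hc]

theorem connectedIn_preimage_mul_left (g u v : V) (ω : Set V) :
    ConnectedIn G ((g * ·) ⁻¹' ω) u v ↔ ConnectedIn G ω (g * u) (g * v) := by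
  have key : ∀ (g u v : V) (ω : Set V), ConnectedIn G ((g * ·) ⁻¹' ω) u v →
      ConnectedIn G ω (g * u) (g * v) := by
    rintro g u v ω ⟨q, hq⟩
    refine ⟨q.map (mulLeftIso hG g).toHom, fun x hx => ?_⟩
    obtain ⟨y, hy, rfl⟩ := List.mem_map.1 (SimpleGraph.Walk.support_map (mulLeftIso hG g).toHom q ▸ hx)
    exact hq y hy
  refine ⟨key g u v ω, fun h => ?_⟩
  have := key g⁻¹ (g * u) (g * v) ((g * ·) ⁻¹' ω) (by simpa [preimage_preimage] using h)
  simpa using this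

theorem isGood_preimage_mul_left (hc : G.Connected) (g v : V) (R : ℝ) (ω : Set V) :
    IsGood G R v ((g * ·) ⁻¹' ω) ↔ IsGood G R (g * v) ω := by
  refine and_congr ?_ ?_
  · exact (Equiv.mulLeft g).exists_congr fun x =>
      and_congr Iff.rfl (mem_ball_mul_left hG hc g v x R).symm
  · refine (Equiv.mulLeft g).exists_congr fun u => and_congr Iff.rfl ?_
    refine (Equiv.mulLeft g).forall_congr fun x => imp_congr
      (and_congr Iff.rfl (mem_ball_mul_left hG hc g v x (3 * R)).symm) ?_
    exact connectedIn_preimage_mul_left hG g u x ω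

theorem linked_preimage_mul_left (hc : G.Connected) (g u v : V) (R : ℝ) (ω : Set V) :
    Linked G R u v ((g * ·) ⁻¹' ω) ↔ Linked G R (g * u) (g * v) ω := by
  refine and_congr (isGood_preimage_mul_left hG hc g u R ω)
    (and_congr (isGood_preimage_mul_left hG hc g v R ω) ?_)
  refine (Equiv.mulLeft g).exists_congr fun a => and_congr
    (and_congr Iff.rfl (mem_ball_mul_left hG hc g u a R).symm) ?_
  refine (Equiv.mulLeft g).exists_congr fun b => and_congr
    (and_congr Iff.rfl (mem_ball_mul_left hG hc g v b R).symm) ?_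
  exact connectedIn_preimage_mul_left hG g a b ω

theorem percolation_shift (hc : G.Connected) (lam p : ℝ) (g : V) (x : Randomness V) :
    percolation G lam p (shift g x) = (g * ·) ⁻¹' percolation G lam p x := by
  ext v
  simp only [percolation, mem_preimage, mem_iUnion, exists_prop]
  refine (Equiv.mulLeft g).exists_congr fun c => and_congr Iff.rfl ?_
  refine (Equiv.mulLeft g).forall_congr fun c' => ?_
  simp only [Equiv.coe_mulLeft, dist_mul_left hG hc, ne_eq, mul_right_inj]
  exact Iff.rfl

end Invariance

/-! ### Insertion tolerance -/

section Insertion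

theorem measurable_mul_left_unitInterval (c : I) : Measurable (c * · : I → I) :=
  (continuous_const.mul continuous_id).measurable

/-- Scaling the uniform distribution conditions it to be small. -/
theorem map_mul_left_volume (c : I) (hc : 0 < (c : ℝ)) :
    (volume : Measure I).map (c * ·) = ENNReal.ofReal (c : ℝ)⁻¹ • volume.restrict (Iic c) := by
  ext s hs
  rw [Measure.map_apply (measurable_mul_left_unitInterval c) hs, Measure.smul_apply,
    Measure.restrict_apply hs, unitInterval.volume_apply, unitInterval.volume_apply, smul_eq_mul]
  have h : Subtype.val '' ((c * · : I → I) ⁻¹' s) =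
      ((c : ℝ) * ·) ⁻¹' (Subtype.val '' (s ∩ Iic c)) := by
    ext x
    constructor
    · rintro ⟨y, hy, rfl⟩
      exact ⟨c * y, ⟨hy, mul_le_of_le_one_right c.2.1 y.2.2⟩, rfl⟩
    · rintro ⟨y, ⟨hy, hyc⟩, hxy⟩
      have hyc' : (y : ℝ) ≤ c := hyc
      change (y : ℝ) = c * x at hxy
      have h0 : 0 ≤ x := by
        by_contra! h
        have := y.2.1
        nlinarith
      have h1 : x ≤ 1 := by
        by_contra! h
        nlinarith
      refine ⟨⟨x, h0, h1⟩, ?_, rfl⟩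
      have : c * ⟨x, h0, h1⟩ = y := Subtype.ext hxy.symm
      rw [mem_preimage, this]
      exact hy
  rw [h, Real.volume_preimage_mul_left hc.ne', abs_of_pos (inv_pos.2 hc)]

/-- Turns a vertex into a point with a black cell, keeping its label. -/
def insertMap (lam p : I) (y : I × I × I) : I × I × I := (lam * y.1, y.2.1, p * y.2.2)

theorem measurable_insertMap (lam p : I) : Measurable (insertMap lam p) :=
  ((measurable_mul_left_unitInterval lam).comp measurable_fst).prodMk
    ((measurable_fst.comp measurable_snd).prodMk
      ((measurable_mul_left_unitInterval p).comp (measurable_snd.comp measurable_snd)))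

theorem map_insertMap (lam p : I) (hlam : 0 < (lam : ℝ)) (hp : 0 < (p : ℝ)) :
    (volume : Measure (I × I × I)).map (insertMap lam p) =
      ENNReal.ofReal ((lam : ℝ) * p)⁻¹ • volume.restrict (Iic lam ×ˢ univ ×ˢ Iic p) := by
  have h1 : insertMap lam p = Prod.map (lam * ·) (Prod.map id (p * ·)) := rfl
  have hm := measurable_mul_left_unitInterval
  rw [h1, Measure.volume_eq_prod, ← Measure.map_prod_map _ _ (hm lam) (measurable_id.prodMap (hm p)),
    Measure.volume_eq_prod, ← Measure.map_prod_map _ _ measurable_id (hm p), Measure.map_id,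
    map_mul_left_volume lam hlam, map_mul_left_volume p hp, ← Measure.prod_restrict,
    ← Measure.prod_restrict, Measure.restrict_univ, Measure.prod_smul_right,
    Measure.prod_smul_left, Measure.prod_smul_right, smul_smul,
    ← ENNReal.ofReal_mul (inv_nonneg.2 hlam.le), mul_inv]

variable {V : Type*}

open Classical in
/-- Turns all vertices of a finite set into points with black cells. -/
def insertBlack (lam p : I) (B : Finset V) (x : Randomness V) : Randomness V :=
  fun v => (if v ∈ B then insertMap lam p else id) (x v)

theorem map_insertBlack (lam p : I) (hlam : 0 < (lam : ℝ)) (hp : 0 < (p : ℝ)) (B : Finset V) :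
    (law V).map (insertBlack lam p B) = ENNReal.ofReal ((lam : ℝ) * p)⁻¹ ^ B.card •
      (law V).restrict ((B : Set V).pi fun _ => Iic lam ×ˢ univ ×ˢ Iic p) := by
  classical
  set D : Set (I × I × I) := Iic lam ×ˢ univ ×ˢ Iic p with hD
  set κ := ENNReal.ofReal ((lam : ℝ) * p)⁻¹ with hκ
  have hDm : MeasurableSet D := measurableSet_Iic.prod (MeasurableSet.univ.prod measurableSet_Iic)
  have hmap := map_insertMap lam p hlam hp
  rw [← hD, ← hκ] at hmap
  -- The pushforward is a probability measure; this normalisation cancels the coordinates of `B` not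
  -- constrained by the test cylinder.
  have hκD : κ * volume D = 1 := by
    have := congrArg (fun m => m univ) hmap
    simpa [Measure.map_apply (measurable_insertMap lam p)] using this.symm
  have hf : ∀ v, Measurable (if v ∈ B then insertMap lam p else id) := fun v => by
    split_ifs
    · exact measurable_insertMap lam p
    · exact measurable_id
  have h1 : (law V).map (insertBlack lam p B) = Measure.infinitePi fun v =>
      (volume : Measure (I × I × I)).map (if v ∈ B then insertMap lam p else id) :=
    Measure.infinitePi_map_pi (fun _ : V => (volume : Measure (I × I × I))) hf
  have hprob : ∀ v, IsProbabilityMeasure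
      ((volume : Measure (I × I × I)).map (if v ∈ B then insertMap lam p else id)) :=
    fun v => Measure.isProbabilityMeasure_map (hf v).aemeasurable
  rw [h1]
  symm
  refine Measure.eq_infinitePi _ fun s t ht => ?_
  have hpi : MeasurableSet ((s : Set V).pi t) :=
    MeasurableSet.pi s.countable_toSet fun i _ => ht i
  set w : V → Set (I × I × I) := fun v =>
    (if v ∈ s then t v else univ) ∩ (if v ∈ B then D else univ) with hw
  have hwm : ∀ v, MeasurableSet (w v) := fun v => by
    refine MeasurableSet.inter ?_ ?_
    · split_ifs
      exacts [ht v, MeasurableSet.univ]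
    · split_ifs
      exacts [hDm, MeasurableSet.univ]
  have h2 : (s : Set V).pi t ∩ (B : Set V).pi (fun _ => D) = ((s ∪ B : Finset V) : Set V).pi w := by
    ext x
    simp only [mem_inter_iff, Set.mem_pi, Finset.mem_coe, Finset.mem_union, hw]
    constructor
    · rintro ⟨h, h'⟩ v -
      refine ⟨?_, ?_⟩
      · split_ifs with hv
        exacts [h v hv, mem_univ _]
      · split_ifs with hv
        exacts [h' v hv, mem_univ _]
    · intro h
      refine ⟨fun v hv => ?_, fun v hv => ?_⟩
      · simpa [hv] using (h v (Or.inl hv)).1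
      · simpa [hv] using (h v (Or.inr hv)).2
  rw [Measure.smul_apply, Measure.restrict_apply hpi, h2, smul_eq_mul, law,
    Measure.infinitePi_pi _ fun v _ => hwm v]
  have h3 : κ ^ B.card = ∏ v ∈ s ∪ B, if v ∈ B then κ else 1 := by
    rw [Finset.prod_ite_mem, Finset.inter_eq_right.2 Finset.subset_union_right, Finset.prod_const]
  rw [h3, ← Finset.prod_mul_distrib, ← Finset.prod_subset Finset.subset_union_left]
  · refine Finset.prod_congr rfl fun v hv => ?_
    by_cases hB : v ∈ B
    · simp only [hw, hv, hB, if_true]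
      rw [hmap, Measure.smul_apply, Measure.restrict_apply (ht v), smul_eq_mul]
    · simp [hw, hv, hB]
  · intro v hv hvs
    have hB : v ∈ B := by simpa [hvs] using hv
    simp [hw, hvs, hB, hκD]

/-- Insertion tolerance. -/
theorem law_real_le_of_insertBlack (lam p : I) (hlam : 0 < (lam : ℝ)) (hp : 0 < (p : ℝ))
    (B : Finset V) {E T : Set (Randomness V)} (hT : MeasurableSet T)
    (h : ∀ᵐ x ∂law V, x ∈ E → insertBlack lam p B x ∈ T) :
    ((lam : ℝ) * p) ^ B.card * (law V).real E ≤ (law V).real T := by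
  classical
  have hm : Measurable (insertBlack lam p B) := by
    refine measurable_pi_lambda _ fun v => ?_
    refine Measurable.comp (g := if v ∈ B then insertMap lam p else id) ?_
      (measurable_pi_apply v : Measurable fun x : Randomness V => x v)
    split_ifs
    · exact measurable_insertMap lam p
    · exact measurable_id
  -- After insertion the law is the original one conditioned on all of `B` being black points, so
  -- its density is at most `(lam * p)⁻¹ ^ B.card`.
  have h1 : law V E ≤ ENNReal.ofReal ((lam : ℝ) * p)⁻¹ ^ B.card * law V T := by
    calc law V E ≤ law V (insertBlack lam p B ⁻¹' T) := measure_mono_ae h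
      _ = (law V).map (insertBlack lam p B) T := (Measure.map_apply hm hT).symm
      _ ≤ _ := by
        rw [map_insertBlack lam p hlam hp, Measure.smul_apply, smul_eq_mul]
        exact mul_le_mul' le_rfl (Measure.restrict_apply_le _ _)
  have h2 := ENNReal.toReal_mono (by finiteness) h1
  rw [ENNReal.toReal_mul, ENNReal.toReal_pow, ENNReal.toReal_ofReal (by positivity), inv_pow,
    inv_mul_eq_div, le_div_iff₀ (by positivity), mul_comm] at h2
  exact h2

/-- Cells require strict comparison, so an inserted point with a tied label could leave a vertex in
no cell. Distinct labels exclude this and make insertion monotone. -/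
theorem ae_injective_label [Countable V] : ∀ᵐ x ∂law V, Function.Injective (label x) := by
  have h : ∀ u v : V, u ≠ v → ∀ᵐ x ∂law V, label x u ≠ label x v := by
    intro u v huv
    have h1 : (law V).map (fun x => (x u, x v)) = volume.prod volume :=
      Measure.infinitePi_map_eval_prod (P := fun _ : V => (volume : Measure (I × I × I))) huv
    set D : Set ((I × I × I) × (I × I × I)) := {q | q.1.2.1 = q.2.2.1} with hD
    have hDm : MeasurableSet D := measurableSet_eq_fun (by fun_prop) (by fun_prop)
    have h2 : (volume.prod volume : Measure ((I × I × I) × (I × I × I))) D = 0 := by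
      rw [Measure.measure_prod_null hDm]
      refine Filter.Eventually.of_forall fun a => ?_
      have : Prod.mk a ⁻¹' D = univ ×ˢ ({a.2.1} ×ˢ univ) := by
        ext b; simp [hD, eq_comm]
      change volume (Prod.mk a ⁻¹' D) = 0
      rw [this, Measure.volume_eq_prod, Measure.prod_prod, Measure.volume_eq_prod,
        Measure.prod_prod]
      simp
    rw [← h1, Measure.map_apply (by fun_prop) hDm] at h2
    rw [ae_iff]
    simpa [label, hD] using h2
  have h' : ∀ᵐ x ∂law V, ∀ u v : V, u ≠ v → label x u ≠ label x v := by
    rw [ae_all_iff]; intro u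
    rw [ae_all_iff]; intro v
    by_cases huv : u = v
    · simp [huv]
    · simpa [huv] using h u v huv
  filter_upwards [h'] with x hx u v huv
  by_contra hne
  exact hx u v hne huv

theorem label_insertBlack (lam p : I) (B : Finset V) (x : Randomness V) (v : V) :
    label (insertBlack lam p B x) v = label x v := by
  by_cases hv : v ∈ B <;> simp [insertBlack, label, insertMap, hv]

theorem insertBlack_of_notMem (lam p : I) {B : Finset V} (x : Randomness V) {v : V} (hv : v ∉ B) :
    insertBlack lam p B x v = x v := by
  simp [insertBlack, hv]

theorem mem_blackPoints_insertBlack (lam p : I) {B : Finset V} (x : Randomness V) {v : V}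
    (hv : v ∈ B) : v ∈ blackPoints (lam : ℝ) (p : ℝ) (insertBlack lam p B x) := by
  have h : ∀ a b : I, ((a * b : I) : ℝ) ≤ a := fun a b => by
    simpa using mul_le_of_le_one_right a.2.1 b.2.2
  refine ⟨?_, ?_⟩ <;> simp only [points, Set.mem_ofPred_eq, insertBlack, hv, if_true, insertMap] <;>
    exact h _ _

theorem subset_percolation_insertBlack (G : SimpleGraph V) (hc : G.Connected) (lam p : I)
    (B : Finset V) (x : Randomness V) :
    (B : Set V) ⊆ percolation G lam p (insertBlack lam p B x) := by
  intro v hv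
  refine mem_biUnion (mem_blackPoints_insertBlack lam p x hv) fun c' _ hne => Or.inl ?_
  rw [SimpleGraph.dist_self]
  exact (hc v c').pos_dist_of_ne hne.symm

/-- Inserting points with black cells increases the configuration. -/
theorem percolation_subset_insertBlack (G : SimpleGraph V) (lam p : I) (B : Finset V)
    {x : Randomness V} (hx : Function.Injective (label x)) :
    percolation G lam p x ⊆ percolation G lam p (insertBlack lam p B x) := by
  classical
  intro v hv
  simp only [percolation, mem_iUnion, exists_prop] at hv
  obtain ⟨c, hcb, hcell⟩ := hv
  set key : V → ℕ ×ₗ I := fun w => toLex (G.dist v w, label x w) with hkey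
  have hlt : ∀ a b : V, key a < key b ↔
      G.dist v a < G.dist v b ∨ (G.dist v a = G.dist v b ∧ label x a < label x b) := fun a b =>
    Prod.Lex.toLex_lt_toLex
  have hinj : Function.Injective key := fun a b hab => by
    have := congrArg (fun q => (ofLex q).2) hab
    exact hx this
  -- Insertion keeps labels, so the new owner of `v` minimises the old key over `c` and `B`; it is
  -- either the old black point or an inserted one.
  obtain ⟨a, ha, hmin⟩ := (insert c B).exists_min_image key ⟨c, Finset.mem_insert_self _ _⟩
  refine mem_biUnion (x := a) ?_ ?_
  · by_cases haB : a ∈ B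
    · exact mem_blackPoints_insertBlack lam p x haB
    · have : a = c := by simpa [haB] using ha
      subst this
      simpa only [blackPoints, points, Set.mem_ofPred_eq, insertBlack_of_notMem lam p x haB]
        using hcb
  · intro c' hc' hne
    rw [label_insertBlack, label_insertBlack, ← hlt]
    by_cases hmem : c' ∈ insert c B
    · exact lt_of_le_of_ne (hmin c' hmem) fun h => hne (hinj h).symm
    · have hB : c' ∉ B := fun h => hmem (Finset.mem_insert_of_mem h)
      have hcc : c' ≠ c := fun h => hmem (h ▸ Finset.mem_insert_self _ _)
      have hp' : c' ∈ points (lam : ℝ) x := by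
        simpa only [points, Set.mem_ofPred_eq, insertBlack_of_notMem lam p x hB] using hc'
      exact lt_of_le_of_lt (hmin c (Finset.mem_insert_self _ _)) ((hlt c c').2 (hcell c' hp' hcc))

/-- The two-point function is bounded below in terms of the probability of being linked. -/
theorem pow_mul_prob_linked_le_prob_connectedIn [Countable V] {G : SimpleGraph V}
    (hc : G.Connected) (lam p : I) (hlam : 0 < (lam : ℝ)) (hp : 0 < (p : ℝ)) (R : ℝ) (u v : V)
    (B : Finset V) (hu : ball G u R ⊆ B) (hv : ball G v R ⊆ B) :
    ((lam : ℝ) * p) ^ B.card * prob G lam p (Linked G R u v) ≤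
      prob G lam p fun ω => ConnectedIn G ω u v := by
  refine law_real_le_of_insertBlack lam p hlam hp B
    (measurableSet_setOfPred.2 ((measurable_connectedIn G u v).comp (measurable_percolation G _ _))) ?_
  filter_upwards [ae_injective_label] with x hx h
  exact Linked.connectedIn_of_subset hc h (percolation_subset_insertBlack G lam p B hx)
    (hu.trans (subset_percolation_insertBlack G hc lam p B x))
    (hv.trans (subset_percolation_insertBlack G hc lam p B x))

end Insertion

/-! ### Cayley graphs and propagation along generators -/

section Cayley

variable {Γ : Type*} [Group Γ]

theorem adj_mul_of_mem {S : Set Γ} (γ : Γ) {s : Γ} (hs : s ∈ S) :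
    γ = γ * s ∨ (SimpleGraph.mulCayley S).Adj γ (γ * s) := by
  by_cases h : γ = γ * s
  · exact Or.inl h
  · exact Or.inr ((SimpleGraph.mulCayley_adj' S _ _).2 ⟨h, s, hs, Or.inl rfl⟩)

theorem connected_mulCayley {S : Set Γ} (hS : Subgroup.closure S = ⊤) :
    (SimpleGraph.mulCayley S).Connected := by
  have hadj : ∀ γ, ∀ s ∈ S, (SimpleGraph.mulCayley S).Reachable γ (γ * s) := fun γ s hs => by
    rcases adj_mul_of_mem γ hs with h | h
    · rw [← h]
    · exact h.reachable
  have h1 : ∀ γ : Γ, (SimpleGraph.mulCayley S).Reachable 1 γ := by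
    intro γ
    have hγ : γ ∈ Subgroup.closure S := hS ▸ Subgroup.mem_top γ
    induction hγ using Subgroup.closure_induction_right with
    | one => exact SimpleGraph.Reachable.refl _
    | mul_right x _ s hs ih => exact ih.trans (hadj x s hs)
    | mul_inv_cancel x _ s hs ih =>
      refine ih.trans ?_
      have := (hadj (x * s⁻¹) s hs).symm
      rwa [inv_mul_cancel_right] at this
  exact (SimpleGraph.connected_iff _).2 ⟨fun u v => (h1 u).symm.trans (h1 v), ⟨1⟩⟩

theorem finite_neighbors_mulCayley (S : Finset Γ) (γ : Γ) :
    {η | (SimpleGraph.mulCayley (S : Set Γ)).Adj γ η}.Finite := by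
  classical
  refine (S.image (γ * ·) ∪ S.image (γ * ·⁻¹)).finite_toSet.subset fun η hη => ?_
  rw [Set.mem_ofPred_eq, SimpleGraph.mulCayley_adj'] at hη
  obtain ⟨-, s, hs, h | h⟩ := hη
  · exact Finset.mem_coe.2 (Finset.mem_union_left _ (Finset.mem_image.2 ⟨s, hs, h⟩))
  · exact Finset.mem_coe.2 (Finset.mem_union_right _ (Finset.mem_image.2 ⟨s, hs, by simp [h]⟩))

/-- A function on a group that avoids intermediate values and changes little along generators is
close to one everywhere if it is so at the identity. -/
theorem one_sub_le_of_mul_one_sub_le {S : Set Γ} (hS : Subgroup.closure S = ⊤) {q : Γ → ℝ}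
    {τ η : ℝ} (hτ : τ ≤ 1 / 8) (hη : η ≤ 3 / 32) (h1 : 1 - τ ≤ q 1)
    (hq1 : ∀ γ, q γ ≤ 1) (hq : ∀ γ, q γ * (1 - q γ) ≤ η)
    (hstep : ∀ γ, ∀ s ∈ S, |q (γ * s) - q γ| ≤ τ) (γ : Γ) :
    1 - 2 * η ≤ q γ := by
  have key : ∀ t, 3 / 4 ≤ t → t ≤ 1 → t * (1 - t) ≤ η → 1 - t ≤ 4 / 3 * η :=
    fun t h h' h'' => by nlinarith
  -- Above `3 / 4` the dichotomy improves the value to at least `1 - 4 / 3 * (3 / 32) = 7 / 8`, and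
  -- one step costs at most `1 / 8`, so the forbidden gap is never crossed.
  have h34 : ∀ γ, 3 / 4 ≤ q γ := by
    intro γ
    have hγ : γ ∈ Subgroup.closure S := hS ▸ Subgroup.mem_top γ
    induction hγ using Subgroup.closure_induction_right with
    | one => linarith
    | mul_right x _ s hs ih =>
      have h2 := key _ ih (hq1 x) (hq x)
      have h3 := (abs_le.1 (hstep x s hs)).1
      linarith
    | mul_inv_cancel x _ s hs ih =>
      have h2 := key _ ih (hq1 x) (hq x)
      have h3 := (abs_le.1 (hstep (x * s⁻¹) s hs)).2
      rw [inv_mul_cancel_right] at h3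
      linarith
  have h2 := key _ (h34 γ) (hq1 γ) (hq γ)
  have h3 := hq1 γ
  linarith

end Cayley

/-! ### Linking probabilities and their stability -/

section LongRange

variable {V : Type*} {G : SimpleGraph V}

theorem measurableSet_linked [Countable V] (G : SimpleGraph V) (lam p R : ℝ) (u v : V) :
    MeasurableSet {x : Randomness V | Linked G R u v (percolation G lam p x)} :=
  measurableSet_setOfPred.2 ((measurable_linked G R u v).comp (measurable_percolation G lam p))

theorem measurableSet_isGood [Countable V] (G : SimpleGraph V) (lam p R : ℝ) (v : V) :
    MeasurableSet {x : Randomness V | IsGood G R v (percolation G lam p x)} :=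
  measurableSet_setOfPred.2 ((measurable_isGood G R v).comp (measurable_percolation G lam p))

theorem prob_le_one (G : SimpleGraph V) (lam p : ℝ) (E : Set V → Prop) : prob G lam p E ≤ 1 :=
  measureReal_le_one

theorem preimage_shift_linked [Group V] (hG : ∀ g u v, G.Adj (g * u) (g * v) ↔ G.Adj u v)
    (hc : G.Connected) (lam p R : ℝ) (g u v : V) :
    shift g ⁻¹' {x | Linked G R u v (percolation G lam p x)} =
      {x | Linked G R (g * u) (g * v) (percolation G lam p x)} := by
  ext x
  rw [mem_preimage, Set.mem_ofPred_eq, percolation_shift hG hc, linked_preimage_mul_left hG hc]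
  rfl

theorem prob_linked_mul_left [Group V] [Countable V]
    (hG : ∀ g u v, G.Adj (g * u) (g * v) ↔ G.Adj u v)
    (hc : G.Connected) (lam p R : ℝ) (g u v : V) :
    prob G lam p (Linked G R (g * u) (g * v)) = prob G lam p (Linked G R u v) := by
  unfold prob
  rw [← preimage_shift_linked hG hc, law_real_preimage_shift g (measurableSet_linked G lam p R u v)]

theorem preimage_shift_isGood [Group V] (hG : ∀ g u v, G.Adj (g * u) (g * v) ↔ G.Adj u v)
    (hc : G.Connected) (lam p R : ℝ) (g v : V) :
    shift g ⁻¹' {x | IsGood G R v (percolation G lam p x)} =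
      {x | IsGood G R (g * v) (percolation G lam p x)} := by
  ext x
  rw [mem_preimage, Set.mem_ofPred_eq, percolation_shift hG hc, isGood_preimage_mul_left hG hc]
  rfl

theorem prob_isGood_mul_left [Group V] [Countable V]
    (hG : ∀ g u v, G.Adj (g * u) (g * v) ↔ G.Adj u v)
    (hc : G.Connected) (lam p R : ℝ) (g v : V) :
    prob G lam p (IsGood G R (g * v)) = prob G lam p (IsGood G R v) := by
  unfold prob
  rw [← preimage_shift_isGood hG hc, law_real_preimage_shift g (measurableSet_isGood G lam p R v)]

/-- Vertices that are adjacent or equal are linked with high probability. -/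
theorem one_sub_two_mul_le_prob_linked [Group V] [Countable V]
    (hG : ∀ g u v, G.Adj (g * u) (g * v) ↔ G.Adj u v)
    (hc : G.Connected) {lam p R ε : ℝ} (hR : 0 < R) (hgood : 1 - ε ≤ prob G lam p (IsGood G R 1))
    {u v : V} (huv : u = v ∨ G.Adj u v) : 1 - 2 * ε ≤ prob G lam p (Linked G R u v) := by
  have hg : ∀ w, 1 - ε ≤ prob G lam p (IsGood G R w) := fun w => by
    have := prob_isGood_mul_left hG hc lam p R w 1
    rw [mul_one] at this
    rwa [this]
  have h1 : ∀ w, (law V).real {x | IsGood G R w (percolation G lam p x)}ᶜ ≤ ε :=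
      fun w => by
    rw [probReal_compl_eq_one_sub (measurableSet_isGood G lam p R w)]
    have := hg w
    unfold prob at this
    linarith
  have h2 : {x | Linked G R u v (percolation G lam p x)}ᶜ ⊆
      {x | IsGood G R u (percolation G lam p x)}ᶜ ∪ {x | IsGood G R v (percolation G lam p x)}ᶜ := by
    intro x hx
    by_contra h
    rw [mem_union, not_or, notMem_compl_iff, notMem_compl_iff] at h
    exact hx (linked_of_isGood hc hR h.1 h.2 huv)
  have h3 := (measureReal_mono (μ := law V) h2).trans (measureReal_union_le _ _)
  rw [probReal_compl_eq_one_sub (measurableSet_linked G lam p R u v)] at h3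
  unfold prob
  linarith [h1 u, h1 v]

/-- By symmetry and transitivity the two events coincide whenever `u` is linked to `u'` and `v` to
`v'`. -/
theorem law_real_symmDiff_linked_le [Countable V] (G : SimpleGraph V) (lam p : ℝ) {R : ℝ} (hR : 0 < R)
    (u v u' v' : V) :
    (law V).real (symmDiff {x | Linked G R u v (percolation G lam p x)}
      {x | Linked G R u' v' (percolation G lam p x)}) ≤
      (1 - prob G lam p (Linked G R u u')) + (1 - prob G lam p (Linked G R v v')) := by
  have h2 : symmDiff {x | Linked G R u v (percolation G lam p x)}
      {x | Linked G R u' v' (percolation G lam p x)} ⊆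
      {x | Linked G R u u' (percolation G lam p x)}ᶜ ∪
        {x | Linked G R v v' (percolation G lam p x)}ᶜ := by
    intro x hx
    by_contra h
    rw [mem_union, not_or, notMem_compl_iff, notMem_compl_iff] at h
    rcases hx with ⟨h1, h2⟩ | ⟨h1, h2⟩
    · exact h2 ((h.1.symm.trans hR h1).trans hR h.2)
    · exact h2 ((h.1.trans hR h1).trans hR h.2.symm)
  have h3 := (measureReal_mono (μ := law V) h2).trans (measureReal_union_le _ _)
  rwa [probReal_compl_eq_one_sub (measurableSet_linked G lam p R _ _),
    probReal_compl_eq_one_sub (measurableSet_linked G lam p R _ _)] at h3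

theorem abs_prob_linked_sub_le [Countable V] (G : SimpleGraph V) (lam p : ℝ) {R : ℝ} (hR : 0 < R)
    (u v u' v' : V) :
    |prob G lam p (Linked G R u v) - prob G lam p (Linked G R u' v')| ≤
      (1 - prob G lam p (Linked G R u u')) + (1 - prob G lam p (Linked G R v v')) :=
  (abs_measureReal_sub_le_measureReal_symmDiff (measurableSet_linked G lam p R u v).nullMeasurableSet
    (measurableSet_linked G lam p R u' v').nullMeasurableSet).trans (law_real_symmDiff_linked_le G lam p hR u v u' v')

end LongRange

/-! ### Long-range linking in the product -/

section Product

variable {Γ Δ : Type*} [Group Γ] [Group Δ]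

theorem boxProd_mulCayley_adj_mul_left (S : Set Γ) (T : Set Δ) (g u v : Γ × Δ) :
    (SimpleGraph.boxProd (SimpleGraph.mulCayley S) (SimpleGraph.mulCayley T)).Adj (g * u) (g * v) ↔
      (SimpleGraph.boxProd (SimpleGraph.mulCayley S) (SimpleGraph.mulCayley T)).Adj u v := by
  simp [SimpleGraph.boxProd_adj]

theorem finite_neighbors_boxProd_mulCayley (S : Finset Γ) (T : Finset Δ) (v : Γ × Δ) :
    {w | (SimpleGraph.boxProd (SimpleGraph.mulCayley (S : Set Γ))
      (SimpleGraph.mulCayley (T : Set Δ))).Adj v w}.Finite := by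
  refine (((finite_neighbors_mulCayley S v.1).prod (finite_singleton v.2)).union
    ((finite_singleton v.1).prod (finite_neighbors_mulCayley T v.2))).subset ?_
  rintro w hw
  rcases SimpleGraph.boxProd_adj.1 hw with ⟨h1, h2⟩ | ⟨h1, h2⟩
  · exact Or.inl ⟨h1, h2.symm⟩
  · exact Or.inr ⟨h2.symm, h1⟩

/-- If vertices are good with sufficiently high probability, then any two vertices are linked with
probability at least `1 / 2`. The non-amenable factor makes the event that two vertices of the same
`Γ`-coordinate are linked almost trivial, and mixing along the infinite factor `Δ` then does so
for vertices of the same `Δ`-coordinate. -/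
theorem exists_one_half_le_prob_linked [Infinite Δ] [Countable (Γ × Δ)] {S : Finset Γ}
    {T : Finset Δ} (hS : Subgroup.closure (S : Set Γ) = ⊤) (hT : Subgroup.closure (T : Set Δ) = ⊤)
    (hX : IsNonamenable (SimpleGraph.mulCayley (S : Set Γ))) :
    ∃ ε : ℝ, 0 < ε ∧ ∀ lam p R : ℝ, 0 < R →
      1 - ε ≤ prob (SimpleGraph.boxProd (SimpleGraph.mulCayley (S : Set Γ))
        (SimpleGraph.mulCayley (T : Set Δ))) lam p (IsGood (SimpleGraph.boxProd
          (SimpleGraph.mulCayley (S : Set Γ)) (SimpleGraph.mulCayley (T : Set Δ))) R 1) →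
      ∀ u v, 1 / 2 ≤ prob (SimpleGraph.boxProd (SimpleGraph.mulCayley (S : Set Γ))
        (SimpleGraph.mulCayley (T : Set Δ))) lam p (Linked (SimpleGraph.boxProd
          (SimpleGraph.mulCayley (S : Set Γ)) (SimpleGraph.mulCayley (T : Set Δ))) R u v) := by
  set G := SimpleGraph.boxProd (SimpleGraph.mulCayley (S : Set Γ))
    (SimpleGraph.mulCayley (T : Set Δ)) with hGdef
  have hG : ∀ g u v, G.Adj (g * u) (g * v) ↔ G.Adj u v := boxProd_mulCayley_adj_mul_left _ _
  have hc : G.Connected := (connected_mulCayley hS).boxProd (connected_mulCayley hT)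
  obtain ⟨C, hC, hgap⟩ := exists_law_real_mul_le_of_isNonamenable (MonoidHom.inl Γ Δ)
    (fun a b h => congrArg Prod.fst h) hX
  -- The first bound makes the step `4 * ε` at most `1 / 8`; the second brings both `4 * C * ε` and
  -- `16 * C * ε` below `3 / 32`. The final loss `40 * C * ε + 2 * ε` is then below `1 / 2`.
  set ε := min (1 / 32) (1 / (200 * C)) with hε
  have hε0 : 0 < ε := by positivity
  have hε1 : ε ≤ 1 / 32 := min_le_left _ _
  have hε2 : C * ε ≤ 1 / 200 := by
    have : ε ≤ 1 / (200 * C) := min_le_right _ _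
    rw [le_div_iff₀ (by positivity)] at this
    linarith
  refine ⟨ε, hε0, fun lam p R hR hgood u v => ?_⟩
  set q : Γ × Δ → Γ × Δ → ℝ := fun u v => prob G lam p (Linked G R u v) with hq
  have hq1 : ∀ u v, q u v ≤ 1 := fun u v => prob_le_one G lam p _
  have hadj : ∀ u v, (u = v ∨ G.Adj u v) → 1 - 2 * ε ≤ q u v := fun u v h =>
    one_sub_two_mul_le_prob_linked hG hc hR hgood h
  have hmul : ∀ g u v, q (g * u) (g * v) = q u v := fun g u v =>
    prob_linked_mul_left hG hc lam p R g u v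
  have habs : ∀ u v u' v', |q u v - q u' v'| ≤ (1 - q u u') + (1 - q v v') :=
    abs_prob_linked_sub_le G lam p hR
  have hsymm : ∀ g u v, (law (Γ × Δ)).real
      (symmDiff {x | Linked G R u v (percolation G lam p x)}
        (shift g ⁻¹' {x | Linked G R u v (percolation G lam p x)})) ≤
      (1 - q u (g * u)) + (1 - q v (g * v)) := fun g u v => by
    rw [preimage_shift_linked hG hc]
    exact law_real_symmDiff_linked_le G lam p hR u v _ _
  have hone : 1 - 2 * ε ≤ q 1 1 := hadj 1 1 (Or.inl rfl)
  have hqone : ∀ w, 1 - q w w ≤ 2 * ε := fun w => by linarith [hadj w w (Or.inl rfl)]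
  have hfst : ∀ (a : Γ) (b : Δ), ∀ s ∈ S, 1 - 2 * ε ≤ q (a, b) (a * s, b) := fun a b s hs => by
    refine hadj _ _ ?_
    rcases adj_mul_of_mem (S := (S : Set Γ)) a hs with h | h
    · exact Or.inl (Prod.ext h rfl)
    · exact Or.inr (SimpleGraph.boxProd_adj_left.2 h)
  have hsnd : ∀ (a : Γ) (b : Δ), ∀ t ∈ T, 1 - 2 * ε ≤ q (a, b) (a, b * t) := fun a b t ht => by
    refine hadj _ _ ?_
    rcases adj_mul_of_mem (S := (T : Set Δ)) b ht with h | h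
    · exact Or.inl (Prod.ext rfl h)
    · exact Or.inr (SimpleGraph.boxProd_adj_right.2 h)
  have hqself : ∀ u v u', |q u v - q u u'| ≤ 1 - q v u' + 2 * ε := fun u v u' => by
    linarith [habs u v u u', hqone u]
  have hvert : ∀ b : Δ, 1 - 2 * (C * (4 * ε)) ≤ q 1 (1, b) := by
    refine one_sub_le_of_mul_one_sub_le (q := fun b => q 1 (1, b)) hT (τ := 4 * ε) (by linarith)
      (by linarith) (by change 1 - 4 * ε ≤ q 1 1; linarith) (fun b => hq1 _ _) (fun b => ?_)
      (fun b t ht => ?_)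
    · refine hgap _ _ (measurableSet_linked G lam p R 1 (1, b)) (by positivity) fun s hs => ?_
      refine (hsymm _ _ _).trans ?_
      have h1 := hfst 1 1 s hs
      have h2 := hfst 1 b s hs
      rw [one_mul] at h1 h2
      have e1 : MonoidHom.inl Γ Δ s * (1 : Γ × Δ) = (s, 1) := by simp
      have e2 : MonoidHom.inl Γ Δ s * ((1, b) : Γ × Δ) = (s, b) := by simp
      rw [e1, e2]
      change 1 - 2 * ε ≤ q 1 (s, 1) at h1
      linarith
    · rw [abs_sub_comm]
      linarith [hqself 1 (1, b) (1, b * t), hsnd 1 b t ht]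
  -- Left multiplication by `s` could move `(a, 1)` far away, so the `Δ`-shifts are used instead.
  -- They move both endpoints within their fibres, and `hvert` bounds the cost by `8 * C * ε` for
  -- each, over arbitrary distances.
  have hhor : ∀ a : Γ, 1 - 2 * (16 * (C * ε)) ≤ q 1 (a, 1) := by
    refine one_sub_le_of_mul_one_sub_le (q := fun a => q 1 (a, 1)) hS (τ := 4 * ε) (by linarith)
      (by linarith) (by change 1 - 4 * ε ≤ q 1 1; linarith) (fun b => hq1 _ _) (fun a => ?_)
      (fun a s hs => ?_)
    · refine law_real_mul_le_of_infinite (MonoidHom.inr Γ Δ) (fun a b h => congrArg Prod.snd h)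
        (measurableSet_linked G lam p R 1 (a, 1)) (by positivity) fun b => ?_
      refine (hsymm _ _ _).trans ?_
      have e1 : MonoidHom.inr Γ Δ b * (1 : Γ × Δ) = (1, b) := by simp
      have e2 : MonoidHom.inr Γ Δ b * ((a, 1) : Γ × Δ) = (a, b) := by simp
      have e3 := hmul (a, 1) 1 (1, b)
      rw [mul_one, Prod.mk_mul_mk, mul_one, one_mul] at e3
      rw [e1, e2, e3]
      linarith [hvert b]
    · rw [abs_sub_comm]
      linarith [hqself 1 (a, 1) (a * s, 1), hfst a 1 s hs]
  obtain ⟨⟨a, b⟩, hab⟩ : ∃ w, w = u⁻¹ * v := ⟨_, rfl⟩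
  have h1 : q u v = q 1 (a, b) := by
    rw [hab, ← hmul u 1, mul_one, mul_inv_cancel_left]
  have e3 := hmul (a, 1) 1 (1, b)
  rw [mul_one, Prod.mk_mul_mk, mul_one, one_mul] at e3
  change 1 / 2 ≤ q u v
  rw [h1]
  have h3 := (abs_le.1 (habs 1 (a, 1) 1 (a, b))).2
  rw [e3] at h3
  linarith [hvert b, hhor a, hqone 1]

end Product

end BernoulliVoronoi

end

/-! ### Conclusion: a uniform lower bound on connection probabilities -/

open BernoulliVoronoi

theorem theorem3p1 {Γ Δ : Type*} [Group Γ] [Group Δ] [Infinite Γ] [Infinite Δ]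
    (S : Finset Γ) (T : Finset Δ)
    (hS : Subgroup.closure (S : Set Γ) = ⊤) (hT : Subgroup.closure (T : Set Δ) = ⊤)
    (hX : BernoulliVoronoi.IsNonamenable (SimpleGraph.mulCayley (S : Set Γ)))
    (hloc : BernoulliVoronoi.LocalUniquenessAtLowIntensities
      (SimpleGraph.boxProd (SimpleGraph.mulCayley (S : Set Γ)) (SimpleGraph.mulCayley (T : Set Δ)))
      ((1, 1) : Γ × Δ)) :
    ∀ p₀ : ℝ, 0 < p₀ → p₀ ≤ 1 → ∃ lam₀ : ℝ, 0 < lam₀ ∧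
      ∀ lam : ℝ, 0 < lam → lam ≤ 1 → lam < lam₀ →
        0 < BernoulliVoronoi.infTwoPoint
          (SimpleGraph.boxProd (SimpleGraph.mulCayley (S : Set Γ))
            (SimpleGraph.mulCayley (T : Set Δ))) lam p₀ := by
  classical
  intro p hp hp1
  have hG := boxProd_mulCayley_adj_mul_left (S : Set Γ) (T : Set Δ)
  have hc := (connected_mulCayley hS).boxProd (connected_mulCayley hT)
  have hfin := finite_neighbors_boxProd_mulCayley S T
  have hcount := countable_of_locallyFinite hfin hc
  obtain ⟨ε, hε, hlinked⟩ := exists_one_half_le_prob_linked hS hT hX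
  obtain ⟨R, hR, lam₀, hlam₀, -, hinf⟩ := hloc p hp hp1 ε hε
  refine ⟨lam₀, hlam₀, fun lam hlam hlam1 hlt => ?_⟩
  set G := SimpleGraph.boxProd (SimpleGraph.mulCayley (S : Set Γ))
    (SimpleGraph.mulCayley (T : Set Δ))
  have hgood : 1 - ε ≤ prob G lam p (IsGood G R 1) :=
    hinf.le.trans (ciInf_le (f := fun lam : Ioc (0 : ℝ) lam₀ => prob G lam p (IsGood G R (1, 1)))
      ⟨0, by rintro _ ⟨_, rfl⟩; exact measureReal_nonneg⟩ ⟨lam, hlam, hlt.le⟩)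
  have hhalf := hlinked lam p R hR hgood
  set B : Finset (Γ × Δ) := (finite_ball hfin hc 1 R).toFinset with hB
  have hball : ∀ u, ball G u R ⊆ (B.image (u * ·) : Finset (Γ × Δ)) := fun u w hw => by
    refine Finset.mem_coe.2 (Finset.mem_image.2 ⟨u⁻¹ * w, ?_, by simp⟩)
    rw [hB, Set.Finite.mem_toFinset, ← mem_ball_mul_left hG hc u]
    simpa using hw
  -- All `R`-balls are translates of one finite ball, so at most `2 * B.card` insertions are needed
  -- for any pair; the factor `1 / 2` is the linking probability.
  have hpos : 0 < (lam * p) ^ (2 * B.card) * (1 / 2) := by positivity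
  refine hpos.trans_le (le_ciInf fun ⟨u, v⟩ => ?_)
  have h1 := pow_mul_prob_linked_le_prob_connectedIn hc ⟨lam, hlam.le, hlam1⟩ ⟨p, hp.le, hp1⟩
    hlam hp R u v (B.image (u * ·) ∪ B.image (v * ·))
    ((hball u).trans (by simp)) ((hball v).trans (by simp))
  refine le_trans ?_ h1
  have hcard : (B.image (u * ·) ∪ B.image (v * ·)).card ≤ 2 * B.card := by
    have h2 := Finset.card_union_le (B.image (u * ·)) (B.image (v * ·))
    have h3 := Finset.card_image_le (s := B) (f := (u * ·))
    have h4 := Finset.card_image_le (s := B) (f := (v * ·))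
    omega
  refine mul_le_mul ?_ (hhalf u v) (by norm_num) (by positivity)
  exact pow_le_pow_of_le_one (by positivity) (mul_le_one₀ hlam1 hp.le hp1) hcard
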